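/- Let $d\ge 1$. A topological $\mathbb Z^d$ dynamical system $(X,S)$ is an action $S$ of $\mathbb Z^d$ by homeomorphisms on a compact metric space $(X,d_X)$. A Borel $\mathbb Z^d$ dynamical system $(Y,T)$ is an action $T$ of $\mathbb Z^d$ by Borel automorphisms on a standard Borel space; it is free if $T^{\mathbf i}y\ne y$ for all $y\in Y$ and $\mathbf i\ne 0$. An almost Borel embedding of $(Y,T)$ into $(X,S)$ is an injective Borel map $\rho:Y_0\to X$ with $\rho\circ T^{\mathbf i}=S^{\mathbf i}\circ\rho$ for all $\mathbf i$, where $Y_0\subseteq Y$ is a $T$-invariant Borel set with $\mu(Y\setminus Y_0)=0$ for every $T$-invariant Borel probability measure $\mu$ on $Y$. For $n\in\mathbb N=\{1,2,\dots\}$ and $t>0$ let $F_n=\{-n,\dots,n\}^d$ and $tF_n=\{-\lfloor tn\rfloor,\dots,\lfloor tn\rfloor\}^d$. A set $F\subseteq\mathbb Z^d$ is $K$-spaced if the sets $\mathbf i+K$, $\mathbf i\in F$, are pairwise disjoint. For $w,w'\in X^{\mathbb Z^d}$ and finite $F\subset\mathbb Z^d$ put $d_X^F(w,w')=\max_{\mathbf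 i\in F}d_X(w_{\mathbf i},w'_{\mathbf i})$; a point $x\in X$ is identified with its orbit $(S^{\mathbf i}x)_{\mathbf i}\in X^{\mathbb Z^d}$, and $S$ also denotes the shift $(S^{\mathbf i}w)_{\mathbf j}=w_{\mathbf i+\mathbf j}$ on $X^{\mathbb Z^d}$. Let $(\epsilon_n)_{n\ge1},(\delta_n)_{n\ge1}$ be monotone decreasing sequences in $(0,1)$ tending to $0$ with $n\delta_n\to\infty$. Write $n\ll m$ if $$\epsilon_m<\tfrac{1}{10^6d}\,\epsilon_n\tfrac{1-\epsilon_n}{|F_n|},\qquad \delta_m<\tfrac{1}{10^6d}\,\delta_n\tfrac{1-\epsilon_n}{|F_n|},\qquad n^2<\tfrac{\delta_m}{1000d}\,m .$$ A sequence $\mathcal C=(C_n)_{n\ge1}$ of finite subsets of $X$ is a flexible marker sequence for $(X,S)$ if, for some such $(\epsilon_n),(\delta_n)$: 1. for every $k$, distinct $x,x'\in C_k$ satisfy $d_X^{F_k}(x,x')>\epsilon_k$; 2. for all $k\ll n$, every $(1+\delta_k)F_k$-spaced set $K\subseteq(1-\delta_n)F_n$ and every $W\in C_k^K$ there is $x\in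 C_n$ with $d_X^{F_k}(S^{\mathbf i}x,W_{\mathbf i})<\frac14\epsilon_k$ for all $\mathbf i\in K$; 3. there is $\epsilon_\star>0$ such that for all $w\in X^{\mathbb Z^d}$ and $n\in\mathbb N$ the set $\{\mathbf i\in\mathbb Z^d: d_X^{F_n}(S^{\mathbf i}w,c)<\epsilon_\star\text{ for some }c\in C_n\}$ is $(1-\delta_n)F_n$-spaced. Put $h(\mathcal C)=\lim_{n\to\infty}\frac1{|F_n|}\log|C_n|$. **Theorem.** Let $(X,S)$ be a topological $\mathbb Z^d$ dynamical system with a flexible marker sequence $\mathcal C=(C_n)_{n\ge 1}$ such that $h(\mathcal C)=\infty$. Then every free Borel $\mathbb Z^d$ dynamical system $(Y,T)$ admits an almost Borel embedding into $(X,S)$. If in addition $X$ has no isolated points and $\bigcup_{k\ge1}C_k$ is dense in $X$, then the almost Borel embedding $\rho$ can be chosen so that for every $T$-invariant Borel probability measure $\mu$ on $Y$ the pushforward $\mu\circ\rho^{-1}$ has full support in $X$. -/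

import Mathlib

open MeasureTheory Filter Topology
open scoped NNReal

namespace FlexEmb

/-- The group `ℤ^d`. -/
abbrev Zd (d : ℕ) : Type := Fin d → ℤ

/-- The box `F_n = {-n, …, n}^d`. -/
noncomputable def box (d n : ℕ) : Finset (Zd d) :=
  Finset.Icc (fun _ => -(n : ℤ)) (fun _ => (n : ℤ))

/-- The scaled box `t F_n = {-⌊t n⌋, …, ⌊t n⌋}^d`, for real `t > 0`. -/
noncomputable def scaledBox (d : ℕ) (t : ℝ) (n : ℕ) : Finset (Zd d) :=
  box d ⌊t * n⌋₊

/-- `F` is `K`-spaced: the translates `i + K`, `i ∈ F`, are pairwise disjoint. -/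
def IsSpaced {d : ℕ} (K : Finset (Zd d)) (F : Set (Zd d)) : Prop :=
  F.Pairwise fun i j =>
    Disjoint ((fun k => i + k) '' (K : Set (Zd d))) ((fun k => j + k) '' (K : Set (Zd d)))

section Metric

variable {d : ℕ} {X : Type*} [MetricSpace X]

/-- `d_X^F(w, w') = max_{i ∈ F} d_X(w_i, w'_i)` for `w, w' ∈ X^{ℤ^d}`. -/
noncomputable def pathDist (F : Finset (Zd d)) (w w' : Zd d → X) : ℝ :=
  ((F.sup fun i => nndist (w i) (w' i) : ℝ≥0) : ℝ)

variable [AddAction (Zd d) X]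

/-- The orbit `(S^i x)_i ∈ X^{ℤ^d}` of a point of `X`. -/
def orbitPath (d : ℕ) {X : Type*} [AddAction (Zd d) X] (x : X) : Zd d → X :=
  fun i => i +ᵥ x

/-- The Bowen metric `d_X^F(x, x') = max_{i ∈ F} d_X(S^i x, S^i x')`. -/
noncomputable def bowenDist (F : Finset (Zd d)) (x x' : X) : ℝ :=
  pathDist F (orbitPath d x) (orbitPath d x')

/-- `(ε, F)`-separated sets. -/
def IsSeparated (ε : ℝ) (F : Finset (Zd d)) (A : Set X) : Prop :=
  A.Pairwise fun x y => ε < bowenDist F x y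

/-- The point `x` shadows `W ∈ X^K` at scale `k`. -/
def Shadows (ε : ℕ → ℝ) (k : ℕ) (K : Finset (Zd d)) (W : K → X) (x : X) : Prop :=
  ∀ i : K, bowenDist (box d k) ((i : Zd d) +ᵥ x) (W i) < ε k / 4

end Metric

/-- Admissible scales. All sequences are indexed by `n ≥ 1`; the value at `0` is ignored. -/
structure IsScalePair (ε δ : ℕ → ℝ) : Prop where
  eps_mem : ∀ n, 1 ≤ n → ε n ∈ Set.Ioo (0 : ℝ) 1
  del_mem : ∀ n, 1 ≤ n → δ n ∈ Set.Ioo (0 : ℝ) 1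
  eps_anti : AntitoneOn ε (Set.Ici 1)
  del_anti : AntitoneOn δ (Set.Ici 1)
  eps_lim : Tendsto ε atTop (𝓝 0)
  del_lim : Tendsto δ atTop (𝓝 0)
  mul_lim : Tendsto (fun n : ℕ => (n : ℝ) * δ n) atTop atTop

/-- The relation `n ≪ m` attached to the scales `ε, δ`. -/
def MuchLess (d : ℕ) (ε δ : ℕ → ℝ) (n m : ℕ) : Prop :=
  ε m < 1 / (10 ^ 6 * (d : ℝ)) * ε n * ((1 - ε n) / ((box d n).card : ℝ)) ∧
  δ m < 1 / (10 ^ 6 * (d : ℝ)) * δ n * ((1 - ε n) / ((box d n).card : ℝ)) ∧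
  (n : ℝ) ^ 2 < δ m / (1000 * (d : ℝ)) * m

section Flexible

variable (d : ℕ) {X : Type*} [MetricSpace X] [AddAction (Zd d) X]

/-- The sequence `(C_n)_{n ≥ 1}` of finite subsets of `X` is flexible with respect to `ε, δ`. -/
structure IsFlexible (ε δ : ℕ → ℝ) (C : ℕ → Finset X) : Prop where
  separated : ∀ k, 1 ≤ k → IsSeparated (ε k) (box d k) (C k : Set X)
  extend : ∀ k n, 1 ≤ k → 1 ≤ n → MuchLess d ε δ k n →
    ∀ K : Finset (Zd d), K ⊆ scaledBox d (1 - δ n) n →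
      IsSpaced (scaledBox d (1 + δ k) k) (K : Set (Zd d)) →
      ∀ W : K → X, (∀ i, W i ∈ C k) → ∃ x ∈ C n, Shadows ε k K W x

/-- The marker property. Here `w` runs over all of `X^{ℤ^d}` and `j ↦ w (i + j)` is its shift
`S^i w`; since `C n` is finite, `d_X^{F_n}(S^i w, C_n) < r` means that some `c ∈ C_n` is at
distance less than `r`. -/
def HasMarkerProperty (δ : ℕ → ℝ) (C : ℕ → Finset X) : Prop :=
  ∃ r : ℝ, 0 < r ∧ ∀ (w : Zd d → X) (n : ℕ), 1 ≤ n →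
    IsSpaced (scaledBox d (1 - δ n) n)
      {i : Zd d | ∃ c ∈ C n, pathDist (box d n) (fun j => w (i + j)) (orbitPath d c) < r}

/-- `C` is a flexible marker sequence for the system `X`. -/
def IsFlexibleMarkerSequence (C : ℕ → Finset X) : Prop :=
  ∃ ε δ : ℕ → ℝ, IsScalePair ε δ ∧ IsFlexible d ε δ C ∧ HasMarkerProperty d δ C

end Flexible

/-- `h(C) = h`, where `h(C) = lim_n |F_n|⁻¹ log |C_n|` in the extended reals. -/
def HasEntropy (d : ℕ) {X : Type*} (C : ℕ → Finset X) (h : EReal) : Prop :=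
  Tendsto (fun n : ℕ => ((Real.log ((C n).card : ℝ) / ((box d n).card : ℝ) : ℝ) : EReal))
    atTop (𝓝 h)

/-- `ρ : Y₀ → X` is an almost Borel embedding of the Borel `ℤ^d` system `Y` into `X`: the domain
`Y₀` is an invariant Borel set whose complement is null for every invariant Borel probability
measure, and `ρ` is Borel, injective and equivariant. -/
structure IsAlmostBorelEmbedding (d : ℕ) {X Y : Type*} [MeasurableSpace X] [AddAction (Zd d) X]
    [MeasurableSpace Y] [AddAction (Zd d) Y] (Y₀ : Set Y) (ρ : Y₀ → X) : Prop where
  measurableSet : MeasurableSet Y₀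
  invariant : ∀ (i : Zd d) (y : Y), y ∈ Y₀ → i +ᵥ y ∈ Y₀
  full : ∀ μ : Measure Y, IsProbabilityMeasure μ → VAddInvariantMeasure (Zd d) Y μ → μ Y₀ᶜ = 0
  measurable : Measurable ρ
  injective : Function.Injective ρ
  equivariant : ∀ (i : Zd d) (y : Y) (hy : y ∈ Y₀),
    ρ ⟨i +ᵥ y, invariant i y hy⟩ = i +ᵥ ρ ⟨y, hy⟩

end FlexEmb

namespace FlexEmb

/-! ### Arithmetic of boxes. -/

section Box

variable {d : ℕ}

/-! The embedding is a limit of block codes. Along rapidly growing scales `n k` (`exists_scales`),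
Borel bases `B k` give towers of disjoint boxes that cover all but `2 ^ (-k)` of every invariant
probability measure (`exists_rokhlin`). Each point gets a word `c k y ∈ C (n k)`, to be placed on
the box based at `y`. Flexibility lets `c (k + 1) y` shadow the step-`k` words at all bases in a
core of the new box. The positions between this core and the inner radius carry a code: it records
`k + 1` bits of the name of every site of the box, under a Borel injection `φ` of `Y` into binary
sequences, and it uses every word of `C (n k)` (`exists_words`). Infinite entropy makes the thin
shell large enough for this.

The losses at the box boundaries are summable, so by Borel–Cantelli almost every point eventually
stays in the cores. Its position `p k` in the `k`-th box is then defined, and `p k +ᵥ c k (-p k +ᵥ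
y)` converges geometrically to `ρ y`, which stays `ε (n k) / 3`-close to the `k`-th word on its
whole box (`IsTower.dist_le`).

The map is injective because `ρ y` can be decoded: the marker property recovers `p k`, separation
then recovers the word, and the word determines the bits written in it. For full support, every word
of `C (n k)` occurs approximately in the orbit of `ρ y` (`exists_embedding`), and in a perfect space
the late `C m` meet every open set (`IsFlexible.eventually_exists_dist_lt`). -/

lemma mem_box {n : ℕ} {i : Zd d} : i ∈ box d n ↔ ∀ t, |i t| ≤ (n : ℤ) := by
  simp [box, Finset.mem_Icc, Pi.le_def, abs_le, forall_and]

lemma zero_mem_box (n : ℕ) : (0 : Zd d) ∈ box d n := by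
  simp [mem_box]

lemma neg_mem_box {n : ℕ} {i : Zd d} (hi : i ∈ box d n) : -i ∈ box d n := by
  simpa [mem_box] using hi

lemma add_mem_box {m n : ℕ} {i j : Zd d} (hi : i ∈ box d m) (hj : j ∈ box d n) :
    i + j ∈ box d (m + n) := by
  rw [mem_box] at *
  intro t
  have := abs_add_le (i t) (j t)
  have := hi t
  have := hj t
  simp only [Pi.add_apply]
  push_cast
  omega

lemma sub_mem_box {m n : ℕ} {i j : Zd d} (hi : i ∈ box d m) (hj : j ∈ box d n) :
    i - j ∈ box d (m + n) := by
  rw [sub_eq_add_neg]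
  exact add_mem_box hi (neg_mem_box hj)

lemma box_mono {m n : ℕ} (h : m ≤ n) : box d m ⊆ box d n := by
  intro i hi
  rw [mem_box] at *
  intro t
  have := hi t
  omega

lemma card_box (n : ℕ) : (box d n).card = (2 * n + 1) ^ d := by
  rw [box, Pi.card_Icc]
  simp only [Int.card_Icc, Finset.prod_const, Finset.card_univ, Fintype.card_fin]
  congr 1
  omega

lemma exists_mem_box (i : Zd d) : ∃ n, i ∈ box d n := by
  refine ⟨∑ t, (i t).natAbs, mem_box.2 fun t => ?_⟩
  have : (i t).natAbs ≤ ∑ t, (i t).natAbs :=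
    Finset.single_le_sum (f := fun t => (i t).natAbs) (fun _ _ => Nat.zero_le _)
      (Finset.mem_univ t)
  rw [Int.abs_eq_natAbs]
  exact_mod_cast this

end Box

/-! ### A Rokhlin lemma uniform in the invariant measure. -/

section Rokhlin

variable {d : ℕ} {Y : Type*} [AddAction (Zd d) Y]

/-- The translates `u +ᵥ B`, `u ∈ F_n`, are pairwise disjoint, and `u` is determined by
`y ∈ u +ᵥ B`. -/
def IsPacked (n : ℕ) (B : Set Y) : Prop :=
  ∀ b ∈ B, ∀ b' ∈ B, ∀ u ∈ box d n, ∀ v ∈ box d n, u +ᵥ b = v +ᵥ b' → u = v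

/-- The union of the translates `u +ᵥ B`, `u ∈ F_n`. -/
def sweep (d n : ℕ) {Y : Type*} [AddAction (Zd d) Y] (B : Set Y) : Set Y :=
  {y | ∃ u ∈ box d n, -u +ᵥ y ∈ B}

variable [MeasurableSpace Y]

lemma measure_vadd_mem (μ : Measure Y) [VAddInvariantMeasure (Zd d) Y μ] (B : Set Y) (i : Zd d) :
    μ {y : Y | i +ᵥ y ∈ B} = μ B :=
  measure_preimage_vadd μ i B

variable [MeasurableConstVAdd (Zd d) Y]

lemma measurableSet_vadd_mem {B : Set Y} (hB : MeasurableSet B) (i : Zd d) :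
    MeasurableSet {y : Y | i +ᵥ y ∈ B} :=
  (measurable_const_vadd i) hB

lemma measurableSet_sweep (n : ℕ) {B : Set Y} (hB : MeasurableSet B) :
    MeasurableSet (sweep d n B) := by
  have : sweep d n B = ⋃ u ∈ box d n, {y : Y | -u +ᵥ y ∈ B} := by
    ext y; simp [sweep]
  rw [this]
  exact Finset.measurableSet_biUnion _ fun u _ => measurableSet_vadd_mem hB _

lemma IsPacked.measure_biUnion {n : ℕ} {B : Set Y} (hB : IsPacked (d := d) n B)
    (hm : MeasurableSet B) (μ : Measure Y) [VAddInvariantMeasure (Zd d) Y μ]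
    {I : Finset (Zd d)} (hI : I ⊆ box d n) :
    μ (⋃ u ∈ I, {y : Y | -u +ᵥ y ∈ B}) = I.card * μ B := by
  rw [measure_biUnion_finset]
  · simp [measure_vadd_mem]
  · intro u hu v hv huv
    refine Set.disjoint_left.2 fun y hy hy' => huv ?_
    exact hB _ hy _ hy' u (hI hu) v (hI hv) (by simp)
  · exact fun u _ => measurableSet_vadd_mem hm _

lemma IsPacked.card_mul_measure_le {n : ℕ} {B : Set Y} (hB : IsPacked (d := d) n B)
    (hm : MeasurableSet B) (μ : Measure Y) [IsProbabilityMeasure μ]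
    [VAddInvariantMeasure (Zd d) Y μ] : ((box d n).card : ENNReal) * μ B ≤ 1 := by
  rw [← hB.measure_biUnion hm μ subset_rfl]
  exact prob_le_one

variable [StandardBorelSpace Y]

/-- Every free Borel action has a Borel maximal discrete set. -/
theorem exists_maximal_discrete (hfree : ∀ (i : Zd d) (y : Y), i ≠ 0 → i +ᵥ y ≠ y) (R : ℕ) :
    ∃ A : Set Y, MeasurableSet A ∧
      (∀ a ∈ A, ∀ i ∈ box d R, i +ᵥ a ∈ A → i = 0) ∧ ∀ y, ∃ i ∈ box d R, i +ᵥ y ∈ A := by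
  classical
  set θ := embeddingReal Y with hθ
  have hθm : Measurable θ := (measurableEmbedding_embeddingReal Y).measurable
  have hθi : Function.Injective θ := (measurableEmbedding_embeddingReal Y).injective
  -- By freeness a rational interval separates `θ y` from its values at the finitely many nearby
  -- translates. So these countably many discrete Borel sets cover `Y`.
  set V : ℚ × ℚ → Set Y := fun p => {y | θ y ∈ Set.Ioo (p.1 : ℝ) p.2} ∩
    ⋂ i ∈ (box d R).erase 0, {y | i +ᵥ y ∉ {y | θ y ∈ Set.Ioo (p.1 : ℝ) p.2}} with hV
  have hVm : ∀ p, MeasurableSet (V p) := fun p => by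
    have h0 : MeasurableSet {y | θ y ∈ Set.Ioo (p.1 : ℝ) p.2} := hθm measurableSet_Ioo
    exact h0.inter (Finset.measurableSet_biInter _ fun i _ =>
      (measurableSet_vadd_mem h0 i).compl)
  have hVdisj : ∀ p, ∀ y ∈ V p, ∀ i ∈ (box d R).erase 0, i +ᵥ y ∉ V p := by
    intro p y hy i hi h
    have := Set.mem_iInter₂.1 hy.2 i hi
    exact this h.1
  have hVcov : ∀ y, ∃ p, y ∈ V p := by
    intro y
    have hnot : θ y ∉ ((((box d R).erase 0).image fun i => θ (i +ᵥ y) : Finset ℝ) : Set ℝ) := by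
      simp only [Finset.coe_image, Set.mem_image, not_exists, not_and]
      intro i hi h
      exact hfree i y (Finset.ne_of_mem_erase hi) (hθi h)
    have hopen : ((((box d R).erase 0).image fun i => θ (i +ᵥ y) : Finset ℝ) : Set ℝ)ᶜ ∈
        𝓝 (θ y) := (Finset.finite_toSet _).isClosed.isOpen_compl.mem_nhds hnot
    obtain ⟨l, u, hlu, hsub⟩ := mem_nhds_iff_exists_Ioo_subset.1 hopen
    obtain ⟨p, hp1, hp2⟩ := exists_rat_btwn hlu.1
    obtain ⟨q, hq1, hq2⟩ := exists_rat_btwn hlu.2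
    refine ⟨(p, q), ⟨hp2, hq1⟩, Set.mem_iInter₂.2 fun i hi h => ?_⟩
    refine hsub ⟨hp1.trans h.1, h.2.trans hq2⟩ ?_
    simp only [Finset.coe_image]
    exact ⟨i, hi, rfl⟩
  obtain ⟨e, he⟩ := exists_surjective_nat (ℚ × ℚ)
  set U : ℕ → Set Y := fun m => V (e m) with hU
  -- Greedy choice: from each piece, add the points with no neighbour chosen earlier.
  set A : ℕ → Set Y := fun m => Nat.rec ∅ (fun m Am => Am ∪
    (U m \ ⋃ i ∈ (box d R).erase 0, {y | i +ᵥ y ∈ Am})) m with hA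
  have hAs : ∀ m, A (m + 1) = A m ∪
    (U m \ ⋃ i ∈ (box d R).erase 0, {y | i +ᵥ y ∈ A m}) := fun m => rfl
  have hAmono : Monotone A := monotone_nat_of_le_succ fun m => by
    rw [hAs]; exact Set.subset_union_left
  have hAm : ∀ m, MeasurableSet (A m) := by
    intro m
    induction m with
    | zero => exact MeasurableSet.empty
    | succ m ih =>
      rw [hAs]
      exact ih.union ((hVm _).diff (Finset.measurableSet_biUnion _ fun i _ =>
        measurableSet_vadd_mem ih i))
  have hent : ∀ y, y ∈ ⋃ m, A m → ∃ m, y ∈ A (m + 1) ∧ y ∈ U m ∧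
      ∀ i ∈ (box d R).erase 0, i +ᵥ y ∉ A m := by
    intro y hy
    rw [Set.mem_iUnion] at hy
    have hne : Nat.find hy ≠ 0 := fun h0 => by
      have := Nat.find_spec hy
      rw [h0] at this
      exact this
    obtain ⟨m, hm⟩ := Nat.exists_eq_succ_of_ne_zero hne
    have h1 := Nat.find_spec hy
    have h2 : y ∉ A m := Nat.find_min hy (by omega)
    rw [hm, Nat.succ_eq_add_one] at h1
    refine ⟨m, h1, ?_⟩
    rw [hAs] at h1
    rcases h1 with h1 | h1
    · exact absurd h1 h2
    · refine ⟨h1.1, fun i hi hc => h1.2 (Set.mem_iUnion₂.2 ⟨i, hi, hc⟩)⟩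
  refine ⟨⋃ m, A m, MeasurableSet.iUnion hAm, ?_, ?_⟩
  · intro a ha i hi hia
    by_contra hi0
    have hiE : i ∈ (box d R).erase 0 := Finset.mem_erase.2 ⟨hi0, hi⟩
    have hiE' : -i ∈ (box d R).erase 0 :=
      Finset.mem_erase.2 ⟨neg_ne_zero.2 hi0, neg_mem_box hi⟩
    obtain ⟨m, hm1, hm2, hm3⟩ := hent a ha
    obtain ⟨m', hm1', hm2', hm3'⟩ := hent _ hia
    rcases lt_trichotomy m m' with h | h | h
    · exact hm3' _ hiE' (by simpa using hAmono (Nat.succ_le_of_lt h) hm1)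
    · subst h
      exact hVdisj _ a hm2 i hiE hm2'
    · exact hm3 _ hiE (hAmono (Nat.succ_le_of_lt h) hm1')
  · intro y
    obtain ⟨p, hp⟩ := hVcov y
    obtain ⟨m, rfl⟩ := he p
    by_cases h : ∃ i ∈ (box d R).erase 0, i +ᵥ y ∈ A m
    · obtain ⟨i, hi, hy⟩ := h
      exact ⟨i, Finset.mem_of_mem_erase hi, Set.mem_iUnion.2 ⟨m, hy⟩⟩
    · refine ⟨0, zero_mem_box R, Set.mem_iUnion.2 ⟨m + 1, ?_⟩⟩
      rw [zero_vadd, hAs]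
      refine Or.inr ⟨hp, fun hc => h ?_⟩
      simpa using hc

/-- The numerator counts a shell of fixed thickness around the box of radius `2 * ρ`. Its two terms
have the same limit `2 ^ d` after division. -/
lemma tendsto_boundary_ratio (d n : ℕ) :
    Tendsto (fun ρ : ℕ => (((4 * ρ + 4 * n + 1 : ℝ)) ^ d - (4 * ρ - 4 * n + 1) ^ d) /
      (2 * ρ + 1) ^ d) atTop (𝓝 0) := by
  have key : ∀ c : ℝ, Tendsto (fun ρ : ℕ => (4 * ρ + c : ℝ) / (2 * ρ + 1)) atTop (𝓝 2) := by
    intro c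
    have h1 : Tendsto (fun ρ : ℕ => (2 : ℝ) + (c - 2) / (2 * ρ + 1)) atTop (𝓝 (2 + 0)) := by
      refine tendsto_const_nhds.add (Tendsto.div_atTop tendsto_const_nhds ?_)
      exact tendsto_atTop_add_const_right _ _
        (tendsto_natCast_atTop_atTop.const_mul_atTop (by norm_num))
    rw [add_zero] at h1
    refine h1.congr fun ρ => ?_
    have : (2 * (ρ : ℝ) + 1) ≠ 0 := by positivity
    field_simp
    ring
  have h := ((key (4 * n + 1)).pow d).sub ((key (-4 * n + 1)).pow d)
  rw [sub_self] at h
  refine h.congr fun ρ => ?_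
  rw [div_pow, div_pow, ← sub_div]
  ring_nf

/-- A Rokhlin lemma uniform over all invariant probability measures. -/
theorem exists_rokhlin (hfree : ∀ (i : Zd d) (y : Y), i ≠ 0 → i +ᵥ y ≠ y) (n : ℕ) {η : ℝ}
    (hη : 0 < η) :
    ∃ B : Set Y, MeasurableSet B ∧ IsPacked (d := d) n B ∧
      ∀ μ : Measure Y, IsProbabilityMeasure μ → VAddInvariantMeasure (Zd d) Y μ →
        μ (sweep d n B)ᶜ ≤ ENNReal.ofReal η := by
  classical
  obtain ⟨ρ, hρ, hρn⟩ : ∃ ρ : ℕ, (((4 * ρ + 4 * n + 1 : ℝ)) ^ d - (4 * ρ - 4 * n + 1) ^ d) /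
      (2 * ρ + 1) ^ d < η ∧ n ≤ ρ :=
    (((tendsto_boundary_ratio d n).eventually_lt_const hη).and (eventually_ge_atTop n)).exists
  set R := 2 * ρ with hR
  obtain ⟨A, hAm, hAd, hAc⟩ := exists_maximal_discrete hfree R
  set θ := embeddingReal Y with hθ
  have hθm : Measurable θ := (measurableEmbedding_embeddingReal Y).measurable
  have hθi : Function.Injective θ := (measurableEmbedding_embeddingReal Y).injective
  have hvinj : ∀ (i j : Zd d) (y : Y), i +ᵥ y = j +ᵥ y → i = j := by
    intro i j y h
    by_contra hne
    refine hfree (i - j) (j +ᵥ y) (sub_ne_zero.2 hne) ?_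
    rw [vadd_vadd, sub_add_cancel, h]
  -- Cells: `y` belongs to the point of `A` in its window with least `θ`-value, and `i` is the
  -- displacement to it.
  let Lead : Y → Zd d → Prop := fun y i => i ∈ box d R ∧ i +ᵥ y ∈ A ∧
    ∀ j ∈ box d R, j +ᵥ y ∈ A → θ (i +ᵥ y) ≤ θ (j +ᵥ y)
  have hLm : ∀ i, MeasurableSet {y | Lead y i} := by
    intro i
    have : {y : Y | ∀ j ∈ box d R, j +ᵥ y ∈ A → θ (i +ᵥ y) ≤ θ (j +ᵥ y)} =
        ⋂ j ∈ box d R, ({y : Y | j +ᵥ y ∈ A}ᶜ ∪ {y | θ (i +ᵥ y) ≤ θ (j +ᵥ y)}) := by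
      ext y
      simp only [Set.mem_iInter, Set.mem_union, Set.mem_compl_iff, Set.mem_ofPred_eq, imp_iff_not_or]
    refine (MeasurableSet.const _).inter ((measurableSet_vadd_mem hAm i).inter ?_)
    change MeasurableSet {y : Y | ∀ j ∈ box d R, j +ᵥ y ∈ A → θ (i +ᵥ y) ≤ θ (j +ᵥ y)}
    rw [this]
    exact Finset.measurableSet_biInter _ fun j _ => (measurableSet_vadd_mem hAm j).compl.union
      (measurableSet_le (hθm.comp (measurable_const_vadd i)) (hθm.comp (measurable_const_vadd j)))
  have hLu : ∀ y i j, Lead y i → Lead y j → i = j := fun y i j hi hj =>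
    hvinj i j y (hθi (le_antisymm (hi.2.2 j hj.1 hj.2.1) (hj.2.2 i hi.1 hi.2.1)))
  have hLe : ∀ y, ∃ i, Lead y i := by
    intro y
    obtain ⟨i₀, hi₀, hi₀'⟩ := hAc y
    obtain ⟨i, hi, hmin⟩ := Finset.exists_min_image ((box d R).filter fun i => i +ᵥ y ∈ A)
      (fun i => θ (i +ᵥ y)) ⟨i₀, by simp [hi₀, hi₀']⟩
    rw [Finset.mem_filter] at hi
    exact ⟨i, hi.1, hi.2, fun j hj hj' => hmin j (Finset.mem_filter.2 ⟨hj, hj'⟩)⟩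
  have hsep : IsPacked (d := d) ρ A := by
    intro b hb b' hb' u hu v hv huv
    have h1 : (u - v) +ᵥ b = b' := by
      rw [sub_eq_neg_add, ← vadd_vadd, huv, vadd_vadd, neg_add_cancel, zero_vadd]
    have := hAd b hb (u - v) (by have := sub_mem_box hu hv; rwa [hR, two_mul]) (h1 ▸ hb')
    exact sub_eq_zero.1 this
  -- Each cell is cut by the lattice of mesh `2 * n + 1` through its leader. The base consists of
  -- the centres of the tiles contained in one cell.
  refine ⟨{y | ∃ i ∈ box d R, (∀ t, (2 * n + 1 : ℤ) ∣ i t) ∧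
    ∀ u ∈ box d n, Lead (u +ᵥ y) (i - u)}, ?_, ?_, ?_⟩
  · have : {y | ∃ i ∈ box d R, (∀ t, (2 * n + 1 : ℤ) ∣ i t) ∧
        ∀ u ∈ box d n, Lead (u +ᵥ y) (i - u)} =
        ⋃ i ∈ (box d R).filter (fun i => ∀ t, (2 * n + 1 : ℤ) ∣ i t),
          ⋂ u ∈ box d n, {y | Lead (u +ᵥ y) (i - u)} := by
      ext y
      simp [and_assoc]
    rw [this]
    exact Finset.measurableSet_biUnion _ fun i _ => Finset.measurableSet_biInter _ fun u _ =>
      measurable_const_vadd u (hLm (i - u))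
  · rintro b ⟨i, -, hi, hL⟩ b' ⟨i', -, hi', hL'⟩ u hu v hv huv
    have h1 := hLu _ _ _ (hL u hu) (huv ▸ hL' v hv)
    ext t
    have h2 : u t - v t = i t - i' t := by
      have := congrFun h1 t
      simp only [Pi.sub_apply] at this
      linarith
    have h3 : (2 * n + 1 : ℤ) ∣ u t - v t := h2 ▸ dvd_sub (hi t) (hi' t)
    have h4 : u t - v t = 0 := by
      refine Int.eq_zero_of_abs_lt_dvd h3 ?_
      have := abs_sub (u t) (v t)
      have := mem_box.1 hu t
      have := mem_box.1 hv t
      omega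
    linarith
  · intro μ hμ hμi
    -- If no point of `A` is seen in this shell, all translates by `F_{2n}` see the same part of
    -- `A`, hence share a leader, and the tile of `y` lies in the cell.
    set D := box d (R + 2 * n) \ box d (R - 2 * n) with hD
    have hsub : (sweep d n {y | ∃ i ∈ box d R, (∀ t, (2 * n + 1 : ℤ) ∣ i t) ∧
        ∀ u ∈ box d n, Lead (u +ᵥ y) (i - u)})ᶜ ⊆ ⋃ j ∈ D, {y | j +ᵥ y ∈ A} := by
      intro y hy
      by_contra hcon
      apply hy
      have hcon' : ∀ j, j +ᵥ y ∈ A → j ∈ box d (R + 2 * n) → j ∈ box d (R - 2 * n) := by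
        intro j hj hjb
        by_contra hjn
        exact hcon (Set.mem_iUnion₂.2 ⟨j, Finset.mem_sdiff.2 ⟨hjb, hjn⟩, hj⟩)
      obtain ⟨i, hi⟩ := hLe y
      have hshift : ∀ w ∈ box d (2 * n), Lead (w +ᵥ y) (i - w) := by
        intro w hw
        refine ⟨?_, ?_, ?_⟩
        · have := hcon' i hi.2.1 (box_mono (by omega) hi.1)
          refine box_mono ?_ (sub_mem_box this hw)
          omega
        · rw [vadd_vadd, sub_add_cancel]; exact hi.2.1
        · intro j hj hjA
          rw [vadd_vadd] at hjA ⊢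
          rw [vadd_vadd, sub_add_cancel]
          refine hi.2.2 _ ?_ hjA
          exact box_mono (by omega) (hcon' _ hjA (add_mem_box hj hw))
      -- The balanced residue lies between `-n` and `n`, so `-u +ᵥ y` is the centre of the tile of
      -- `y`.
      set u : Zd d := fun t => -(Int.bmod (i t) (2 * n + 1)) with hu
      have hub : u ∈ box d n := by
        rw [mem_box]
        intro t
        simp only [hu, abs_neg]
        have h1 := Int.bmod_lt (x := i t) (m := 2 * n + 1) (by omega)
        have h2 := Int.le_bmod (x := i t) (m := 2 * n + 1) (by omega)
        rw [abs_le]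
        push_cast at h1 h2
        omega
      refine ⟨u, hub, i + u, ?_, ?_, ?_⟩
      · have := (hshift (-u) (box_mono (by omega) (neg_mem_box hub))).1
        rwa [sub_neg_eq_add] at this
      · intro t
        have := Int.dvd_self_sub_bmod (x := i t) (m := 2 * n + 1)
        push_cast at this
        simpa [hu, ← sub_eq_add_neg] using this
      · intro v hv
        have := hshift (v - u) (by have := sub_mem_box hv hub; rwa [two_mul])
        rw [vadd_vadd, ← sub_eq_add_neg, add_sub_right_comm, show i - v + u = i - (v - u) from (sub_sub_eq_add_sub i v u).trans (add_sub_right_comm i u v) |>.symm]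
        exact this
    have hcard : (D.card : ℝ) = (4 * ρ + 4 * n + 1 : ℝ) ^ d - (4 * ρ - 4 * n + 1) ^ d := by
      rw [hD, Finset.card_sdiff_of_subset (box_mono (by omega)),
        Nat.cast_sub (Finset.card_le_card (box_mono (by omega))), card_box, card_box]
      have : 2 * n ≤ R := by omega
      push_cast [Nat.cast_sub this]
      rw [hR]
      push_cast
      ring
    -- Discreteness at radius `2 * ρ` makes the boxes of radius `ρ` around `A` disjoint. This bounds
    -- `μ A` for all `μ` at once.
    have hA1 : (2 * (ρ : ℝ) + 1) ^ d * μ.real A ≤ 1 := by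
      have := ENNReal.toReal_mono ENNReal.one_ne_top (hsep.card_mul_measure_le hAm μ)
      rw [ENNReal.toReal_mul, card_box, ENNReal.toReal_natCast] at this
      push_cast at this
      simpa [Measure.real] using this
    have h1 : μ (⋃ j ∈ D, {y | j +ᵥ y ∈ A}) ≤ D.card * μ A := by
      refine (measure_biUnion_finset_le _ _).trans ?_
      simp [measure_vadd_mem]
    refine (measure_mono hsub).trans (h1.trans ?_)
    rw [ENNReal.le_ofReal_iff_toReal_le (by finiteness) hη.le, ENNReal.toReal_mul,
      ENNReal.toReal_natCast]
    refine le_trans ?_ hρ.le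
    rw [← hcard, le_div_iff₀ (by positivity), mul_assoc]
    have h2 : μ.real A * (2 * (ρ : ℝ) + 1) ^ d ≤ 1 := by rwa [mul_comm] at hA1
    exact mul_le_of_le_one_right (Nat.cast_nonneg _) h2

end Rokhlin

/-! ### Codes and code positions. -/

section Coding

/-- A code with arbitrary alphabet `C` all of whose code words use every letter. -/
lemma exists_surjective_code {M ι X : Type*} [Fintype M] (E : Finset ι) (C : Finset X) (g : ℕ)
    (hC : C.Nonempty) (hM : Fintype.card M ≤ C.card ^ g) (hE : g + C.card ≤ E.card) :
    ∃ enc : M → ι → X, (∀ m, ∀ e ∈ E, enc m e ∈ C) ∧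
      (∀ m m', (∀ e ∈ E, enc m e = enc m' e) → m = m') ∧
      ∀ m, ∀ c ∈ C, ∃ e ∈ E, enc m e = c := by
  classical
  -- The first `g` positions spell the message, the next `C.card` list the alphabet once, and the
  -- rest are filled with a default letter.
  obtain ⟨f⟩ : Nonempty ((Fin g ⊕ C) ↪ E) :=
    Function.Embedding.nonempty_of_card_le (by simpa using hE)
  obtain ⟨w⟩ : Nonempty (M ↪ (Fin g → C)) :=
    Function.Embedding.nonempty_of_card_le (by simpa using hM)
  obtain ⟨c₀, hc₀⟩ := hC
  have hf : Function.Injective (fun s => (f s : ι)) := Subtype.val_injective.comp f.injective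
  refine ⟨fun m => Function.extend (fun s => (f s : ι))
    (Sum.elim (fun i => (w m i : X)) (fun c => (c : X))) fun _ => c₀, ?_, ?_, ?_⟩
  · intro m e _
    by_cases h : ∃ s, (f s : ι) = e
    · obtain ⟨s, rfl⟩ := h
      beta_reduce
      rw [hf.extend_apply]
      rcases s with s | s <;> simp
    · beta_reduce
      rw [Function.extend_apply' _ _ _ h]
      exact hc₀
  · intro m m' h
    refine w.injective (funext fun i => Subtype.ext ?_)
    have := h (f (Sum.inl i)) (f _).2
    beta_reduce at this
    rwa [hf.extend_apply, hf.extend_apply] at this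
  · intro m c hc
    refine ⟨f (Sum.inr ⟨c, hc⟩), (f _).2, ?_⟩
    beta_reduce
    rw [hf.extend_apply]
    rfl

variable {d : ℕ}

lemma disjoint_translates {a : ℕ} {i j : Zd d} (h : ∃ t, 2 * (a : ℤ) < |i t - j t|) :
    Disjoint ((fun k => i + k) '' (box d a : Set (Zd d)))
      ((fun k => j + k) '' (box d a : Set (Zd d))) := by
  obtain ⟨t, ht⟩ := h
  rw [Set.disjoint_left]
  rintro _ ⟨u, hu, rfl⟩ ⟨v, hv, huv⟩
  have h1 := congrFun huv t
  simp only [Pi.add_apply] at h1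
  have h2 := mem_box.1 (Finset.mem_coe.1 hu) t
  have h3 := mem_box.1 (Finset.mem_coe.1 hv) t
  have h4 : i t - j t = v t - u t := by linarith
  have h5 := abs_sub (v t) (u t)
  rw [h4] at ht
  omega

/-- A set of `G ^ d` code positions in the box of radius `q`, far from the box of radius `R`. -/
lemma exists_grid (hd : 0 < d) {a R G q : ℕ} (h : R + (2 * a + 1) * (G + 1) ≤ q) :
    ∃ E ⊆ box d q, E.card = G ^ d ∧
      (∀ e ∈ E, ∀ e' ∈ E, e ≠ e' → ∃ t, 2 * (a : ℤ) < |e t - e' t|) ∧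
      ∀ e ∈ E, ∀ i ∈ box d R, ∃ t, 2 * (a : ℤ) < |e t - i t| := by
  classical
  -- A grid in the positive corner of the shell. Its `0`-th coordinates alone keep it away from the
  -- inner box.
  let p : (Fin d → Fin G) → Zd d := fun z t => (R + (2 * a + 1) * (z t + 1) : ℕ)
  have hp : ∀ z z' t, p z t - p z' t = (2 * a + 1) * ((z t : ℤ) - z' t) := by
    intro z z' t
    simp only [p]
    push_cast
    ring
  have hpi : Function.Injective p := by
    intro z z' hz
    ext t
    have h1 := hp z z' t
    rw [hz, sub_self] at h1
    rcases mul_eq_zero.1 h1.symm with h2 | h2 <;> omega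
  refine ⟨Finset.univ.image p, ?_, ?_, ?_, ?_⟩
  · intro e he
    obtain ⟨z, -, rfl⟩ := Finset.mem_image.1 he
    rw [mem_box]
    intro t
    have h1 : (z t : ℕ) + 1 ≤ G + 1 := by have := (z t).2; omega
    have h2 := Nat.mul_le_mul_left (2 * a + 1) h1
    simp only [p, Nat.abs_cast, Nat.cast_le]
    omega
  · rw [Finset.card_image_of_injective _ hpi]
    simp
  · intro e he e' he' hne
    obtain ⟨z, -, rfl⟩ := Finset.mem_image.1 he
    obtain ⟨z', -, rfl⟩ := Finset.mem_image.1 he'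
    obtain ⟨t, ht⟩ := Function.ne_iff.1 hne
    refine ⟨t, ?_⟩
    have h1 := hp z z' t
    have h2 : (z t : ℤ) - z' t ≠ 0 := fun h0 => by
      rw [h0, mul_zero] at h1
      exact ht (sub_eq_zero.1 h1)
    rw [h1, abs_mul]
    have h3 := Int.one_le_abs h2
    have h4 : |(2 * a + 1 : ℤ)| = 2 * a + 1 := abs_of_nonneg (by positivity)
    rw [h4]
    nlinarith
  · intro e he i hi
    obtain ⟨z, -, rfl⟩ := Finset.mem_image.1 he
    refine ⟨⟨0, hd⟩, lt_of_lt_of_le ?_ (le_abs_self _)⟩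
    have h1 := (abs_le.1 (mem_box.1 hi ⟨0, hd⟩)).2
    simp only [p]
    push_cast
    nlinarith [(Nat.cast_nonneg (z ⟨0, hd⟩ : ℕ) : (0 : ℤ) ≤ _)]

end Coding

/-! ### Choice of the scales. -/

section Scales

variable {d : ℕ} {X : Type*}

/-- The radius of the box by which markers of scale `n` are spaced. -/
noncomputable def outerRadius (δ : ℕ → ℝ) (n : ℕ) : ℕ := ⌊(1 + δ n) * n⌋₊

/-- The radius of the box in which words of smaller scale can be prescribed. -/
noncomputable def innerRadius (δ : ℕ → ℝ) (n : ℕ) : ℕ := ⌊(1 - δ n) * n⌋₊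

/-- The radius of the part of a box of scale `n` that is kept for copying in the `k`-th step. -/
noncomputable def coreRadius (k n : ℕ) : ℕ := ⌊(1 - (1 / 2 : ℝ) ^ (k + 1)) * n⌋₊

/-- Messages of `κ` bits per site of `F_m` can be written with words from `C n` at positions in
the box of radius `q` so that the boxes of radius `a` around these positions are disjoint from
each other and from those around the points of the box of radius `R`. -/
def HasCode (d : ℕ) (C : ℕ → Finset X) (κ n m R a q : ℕ) : Prop :=
  ∃ (E : Finset (Zd d)) (enc : (box d m → Fin κ → Bool) → Zd d → X),
    E ⊆ box d q ∧ (∀ e ∈ E, ∀ e' ∈ E, e ≠ e' → ∃ t, 2 * (a : ℤ) < |e t - e' t|) ∧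
    (∀ e ∈ E, ∀ i ∈ box d R, ∃ t, 2 * (a : ℤ) < |e t - i t|) ∧
    (∀ w, ∀ e ∈ E, enc w e ∈ C n) ∧
    (∀ w w', (∀ e ∈ E, enc w e = enc w' e) → w = w') ∧
    ∀ w, ∀ c ∈ C n, ∃ e ∈ E, enc w e = c

lemma coreRadius_le (k n : ℕ) : (coreRadius k n : ℝ) ≤ (1 - (1 / 2 : ℝ) ^ (k + 1)) * n := by
  refine Nat.floor_le (mul_nonneg ?_ (Nat.cast_nonneg _))
  have : (1 / 2 : ℝ) ^ (k + 1) ≤ 1 := pow_le_one₀ (by norm_num) (by norm_num)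
  linarith

lemma outerRadius_le {ε δ : ℕ → ℝ} (h : IsScalePair ε δ) {n : ℕ} (hn : 1 ≤ n) :
    (outerRadius δ n : ℝ) ≤ (1 + δ n) * n := by
  have := (h.del_mem n hn).1
  exact Nat.floor_le (by positivity)

lemma le_outerRadius {ε δ : ℕ → ℝ} (h : IsScalePair ε δ) {n : ℕ} (hn : 1 ≤ n) :
    n ≤ outerRadius δ n := by
  have := (h.del_mem n hn).1
  refine Nat.le_floor ?_
  have : (0 : ℝ) ≤ δ n * n := by positivity
  linarith

lemma innerRadius_le {ε δ : ℕ → ℝ} (h : IsScalePair ε δ) {n : ℕ} (hn : 1 ≤ n) :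
    innerRadius δ n ≤ n := by
  have h1 := h.del_mem n hn
  refine Nat.floor_le_of_le ?_
  have : (0 : ℝ) ≤ δ n * n := mul_nonneg h1.1.le (Nat.cast_nonneg _)
  linarith

/-- Eventually, any fixed amount fits between the core and the inner radius. -/
lemma eventually_gap {ε δ : ℕ → ℝ} (h : IsScalePair ε δ) (k : ℕ) (c : ℝ) :
    ∀ᶠ m in atTop, (coreRadius k m : ℝ) + (1 / 2 : ℝ) ^ (k + 1) * m / 2 + c ≤
      innerRadius δ m := by
  set s : ℝ := (1 / 2 : ℝ) ^ (k + 1) with hs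
  have hs0 : 0 < s := by positivity
  have h1 : ∀ᶠ m in atTop, δ m < s / 4 := h.del_lim.eventually_lt_const (by positivity)
  have h2 : ∀ᶠ m : ℕ in atTop, c + 1 ≤ s / 4 * m :=
    (tendsto_natCast_atTop_atTop.const_mul_atTop (by positivity)).eventually_ge_atTop _
  filter_upwards [h1, h2] with m h1 h2
  have h3 := coreRadius_le k m
  have h4 : (1 - δ m) * m < innerRadius δ m + 1 := Nat.lt_floor_add_one _
  have h5 : δ m * m ≤ s / 4 * m := mul_le_mul_of_nonneg_right h1.le (Nat.cast_nonneg _)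
  rw [← hs] at h3
  linarith

lemma eventually_muchLess (hd : 0 < d) {ε δ : ℕ → ℝ} (h : IsScalePair ε δ) {n : ℕ} (hn : 1 ≤ n) :
    ∀ᶠ m in atTop, MuchLess d ε δ n m := by
  have hd' : (0 : ℝ) < d := by exact_mod_cast hd
  have he := h.eps_mem n hn
  have hdel := h.del_mem n hn
  have hc : (0 : ℝ) < (box d n).card := by rw [card_box]; positivity
  have h1e : 0 < 1 - ε n := by linarith [he.2]
  have he0 := he.1
  have hdel0 := hdel.1
  refine (h.eps_lim.eventually_lt_const (by positivity)).and
    ((h.del_lim.eventually_lt_const (by positivity)).and ?_)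
  filter_upwards [h.mul_lim.eventually_gt_atTop ((n : ℝ) ^ 2 * (1000 * d))] with m hm
  rw [div_mul_eq_mul_div, lt_div_iff₀ (by positivity)]
  linarith

/-- With enough entropy at scale `n`, codes exist at all large scales. -/
lemma eventually_hasCode (hd : 0 < d) {ε δ : ℕ → ℝ} (h : IsScalePair ε δ) {C : ℕ → Finset X}
    {k n : ℕ} (hn : 1 ≤ n) (hC : (C n).Nonempty)
    (hlog : 2 * (k + 1) * (30 * 2 ^ (k + 2)) ^ d * ((box d n).card : ℝ) ≤
      Real.log ((C n).card : ℝ)) :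
    ∀ᶠ m in atTop, HasCode d C (k + 1) n m (coreRadius (k + 1) m + coreRadius k n)
      (outerRadius δ n) (innerRadius δ m) := by
  set s : ℝ := (1 / 2 : ℝ) ^ (k + 2) with hs
  have hs0 : 0 < s := by positivity
  set a := outerRadius δ n with ha
  set w : ℝ := 2 * a + 1 with hw
  have hw0 : 0 < w := by positivity
  have hn1 : (1 : ℝ) ≤ n := by exact_mod_cast hn
  have hwn : w ≤ 5 * n := by
    have h1 := outerRadius_le h hn
    have h2 : (1 + δ n) * n ≤ 2 * n :=
      mul_le_mul_of_nonneg_right (by linarith [(h.del_mem n hn).2]) (Nat.cast_nonneg _)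
    linarith
  have hbig : Tendsto (fun m : ℕ => s / (2 * w) * m) atTop atTop :=
    tendsto_natCast_atTop_atTop.const_mul_atTop (by positivity)
  filter_upwards [eventually_gap h (k + 1) (coreRadius k n + 2 * w),
    hbig.eventually_ge_atTop (2 * (C n).card + 1), eventually_ge_atTop 1] with m h1 h2 hm
  have hm1 : (1 : ℝ) ≤ m := by exact_mod_cast hm
  -- With spacing `w`, a side of `G` positions takes about half of the shell width `s * m`. The
  -- other half absorbs rounding.
  set G := ⌈s / (2 * w) * m⌉₊ with hG
  have hG1 : s / (2 * w) * m ≤ G := Nat.le_ceil _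
  have hG2 : (G : ℝ) < s / (2 * w) * m + 1 := Nat.ceil_lt_add_one (by positivity)
  have hgrid : coreRadius (k + 1) m + coreRadius k n + (2 * a + 1) * (G + 1) ≤
      innerRadius δ m := by
    have h3 : w * (G + 1) ≤ s * m / 2 + 2 * w := by
      have h4 : w * (G + 1) ≤ w * (s / (2 * w) * m + 1 + 1) :=
        mul_le_mul_of_nonneg_left (by linarith) hw0.le
      have h5 : w * (s / (2 * w) * m + 1 + 1) = s * m / 2 + 2 * w := by
        field_simp
        ring
      linarith
    have h6 : ((coreRadius (k + 1) m + coreRadius k n + (2 * a + 1) * (G + 1) : ℕ) : ℝ) ≤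
        innerRadius δ m := by
      push_cast
      rw [← hw]
      have : (1 / 2 : ℝ) ^ (k + 1 + 1) = s := rfl
      rw [this] at h1
      linarith
    exact_mod_cast h6
  obtain ⟨E, hE1, hE2, hE3, hE4⟩ := exists_grid hd hgrid
  have hGC : 2 * (C n).card ≤ G ^ d := by
    have h3 : (2 * (C n).card : ℝ) ≤ G := by linarith
    have h4 : 2 * (C n).card ≤ G := by exact_mod_cast h3
    exact h4.trans (Nat.le_self_pow hd.ne' G)
  have hmsg : Fintype.card (box d m → Fin (k + 1) → Bool) ≤
      (C n).card ^ (G ^ d - (C n).card) := by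
    have hCpos : (0 : ℝ) < (C n).card := by exact_mod_cast hC.card_pos
    have hcard : Fintype.card (box d m → Fin (k + 1) → Bool) =
        2 ^ ((k + 1) * (2 * m + 1) ^ d) := by
      simp [card_box, pow_mul]
    rw [hcard]
    have key : ((2 ^ ((k + 1) * (2 * m + 1) ^ d) : ℕ) : ℝ) ≤
        (((C n).card ^ (G ^ d - (C n).card) : ℕ) : ℝ) := by
      push_cast
      rw [← Real.log_le_log_iff (by positivity) (by positivity), Real.log_pow, Real.log_pow]
      -- Listing the alphabet costs at most half of the positions, whence the factor `2` in `hlog`.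
      have hg : (G : ℝ) ^ d / 2 ≤ ((G ^ d - (C n).card : ℕ) : ℝ) := by
        rw [Nat.cast_sub (by omega)]
        have : (2 * (C n).card : ℝ) ≤ (G : ℝ) ^ d := by exact_mod_cast hGC
        push_cast
        linarith
      have hl2 : Real.log 2 ≤ 1 := by linarith [Real.log_two_lt_d9]
      have hbn : (n : ℝ) ^ d ≤ (box d n).card := by
        rw [card_box]
        push_cast
        exact pow_le_pow_left₀ (by positivity) (by linarith) d
      have hGp : (s / (2 * w) * m) ^ d ≤ (G : ℝ) ^ d := pow_le_pow_left₀ (by positivity) hG1 d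
      -- Here `30 = 2 * 3 * 5`, from the halving in `G`, from `2 * m + 1 ≤ 3 * m` and from `w ≤ 5 *
      -- n`.
      have hbase : (2 * m + 1 : ℝ) ≤ s / (2 * w) * m * (30 * 2 ^ (k + 2)) * n := by
        have h30 : s * 2 ^ (k + 2) = 1 := by
          rw [hs, ← mul_pow]; norm_num
        have h31 : s / (2 * w) * m * (30 * 2 ^ (k + 2)) * n =
            (s * 2 ^ (k + 2)) * (15 * m * n / w) := by
          field_simp
          ring
        rw [h31, h30, one_mul, le_div_iff₀ hw0]
        nlinarith
      have hpow := pow_le_pow_left₀ (by positivity) hbase d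
      rw [mul_pow, mul_pow] at hpow
      calc (((k + 1) * (2 * m + 1) ^ d : ℕ) : ℝ) * Real.log 2
          ≤ (((k + 1) * (2 * m + 1) ^ d : ℕ) : ℝ) * 1 := by gcongr
        _ = (k + 1) * (2 * m + 1) ^ d := by push_cast; ring
        _ ≤ (k + 1) * ((s / (2 * w) * m) ^ d * (30 * 2 ^ (k + 2)) ^ d * n ^ d) := by gcongr
        _ ≤ (k + 1) * ((G : ℝ) ^ d * (30 * 2 ^ (k + 2)) ^ d * (box d n).card) := by gcongr
        _ = (G : ℝ) ^ d / 2 * (2 * (k + 1) * (30 * 2 ^ (k + 2)) ^ d * (box d n).card) := by ring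
        _ ≤ (G : ℝ) ^ d / 2 * Real.log (C n).card := by gcongr
        _ ≤ _ := mul_le_mul_of_nonneg_right hg (Real.log_natCast_nonneg _)
    exact_mod_cast key
  obtain ⟨enc, henc⟩ := exists_surjective_code E (C n) (G ^ d - (C n).card) hC hmsg (by omega)
  exact ⟨E, enc, hE1, hE3, hE4, henc⟩

/-- Properties of the scale used in the `k`-th step. -/
structure GoodScale (d : ℕ) (δ : ℕ → ℝ) (C : ℕ → Finset X) (k n : ℕ) : Prop where
  one_le : 1 ≤ n
  shell : ((box d (outerRadius δ n)).card : ℝ) - (box d (coreRadius k n)).card ≤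
    2 * d * (1 / 2 : ℝ) ^ (k + 1) * (box d (outerRadius δ n)).card
  core_add : coreRadius k n + k ≤ n
  nonempty : (C n).Nonempty
  log_card : 2 * (k + 1) * (30 * 2 ^ (k + 2)) ^ d * ((box d n).card : ℝ) ≤
    Real.log ((C n).card : ℝ)

/-- Relations between the scales used in two successive steps. -/
structure GoodPair (d : ℕ) (ε δ : ℕ → ℝ) (C : ℕ → Finset X) (k n m : ℕ) : Prop where
  muchLess : MuchLess d ε δ n m
  core_le : coreRadius (k + 1) m + coreRadius k n + n ≤ innerRadius δ m
  code : HasCode d C (k + 1) n m (coreRadius (k + 1) m + coreRadius k n)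
      (outerRadius δ n) (innerRadius δ m)

lemma eventually_goodScale {ε δ : ℕ → ℝ} (h : IsScalePair ε δ) {C : ℕ → Finset X}
    (hent : HasEntropy d C ⊤) (k : ℕ) : ∀ᶠ n in atTop, GoodScale d δ C k n := by
  set s : ℝ := (1 / 2 : ℝ) ^ (k + 1) with hs
  have hs0 : 0 < s := by positivity
  have h1 : ∀ᶠ m in atTop, δ m < s / 2 := h.del_lim.eventually_lt_const (by positivity)
  -- The `k` gives `core_add`, and the `2` absorbs the rounding in `hratio`.
  have h2 : ∀ᶠ m : ℕ in atTop, (k + 2 : ℝ) ≤ s * m :=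
    (tendsto_natCast_atTop_atTop.const_mul_atTop (by positivity)).eventually_ge_atTop _
  have h3 := EReal.tendsto_nhds_top_iff_real.1 hent (2 * (k + 1) * (30 * 2 ^ (k + 2)) ^ d)
  filter_upwards [h1, h2, h3, eventually_ge_atTop 1] with n h1 h2 h3 hn
  have hcard : (0 : ℝ) < (box d n).card := by rw [card_box]; positivity
  have h3' := (lt_div_iff₀ hcard).1 (EReal.coe_lt_coe_iff.1 h3)
  have hcore := coreRadius_le k n
  have hk0 : (0 : ℝ) ≤ k := Nat.cast_nonneg k
  refine ⟨hn, ?_, ?_, ?_, h3'.le⟩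
  · have hcore' : (1 - s) * n < coreRadius k n + 1 := Nat.lt_floor_add_one _
    have hout := outerRadius_le h hn
    have hout' : (n : ℝ) ≤ outerRadius δ n := by exact_mod_cast le_outerRadius h hn
    set a : ℝ := (outerRadius δ n : ℝ)
    set c : ℝ := (coreRadius k n : ℝ)
    have ha : (0 : ℝ) < 2 * a + 1 := by positivity
    have hdn : δ n * n ≤ s / 2 * n := mul_le_mul_of_nonneg_right h1.le (Nat.cast_nonneg _)
    have hratio : 1 + -(2 * s) ≤ (2 * c + 1) / (2 * a + 1) := by
      rw [le_div_iff₀ ha]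
      have : s * n ≤ s * a := mul_le_mul_of_nonneg_left hout' hs0.le
      nlinarith
    have hs1 : s ≤ 1 / 2 := by
      rw [hs, pow_succ]
      have : (1 / 2 : ℝ) ^ k ≤ 1 := pow_le_one₀ (by norm_num) (by norm_num)
      linarith
    -- Bernoulli's inequality turns the ratio of sides into the ratio of volumes.
    have hb := (one_add_mul_le_pow (a := -(2 * s)) (by linarith) d).trans
      (pow_le_pow_left₀ (by linarith) hratio d)
    rw [div_pow, le_div_iff₀ (by positivity)] at hb
    rw [card_box, card_box]
    push_cast
    nlinarith
  · have : ((coreRadius k n + k : ℕ) : ℝ) ≤ n := by push_cast; linarith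
    exact_mod_cast this
  · rw [← Finset.card_pos]
    by_contra h0
    have h0' : (C n).card = 0 := by omega
    -- An empty `C n` would have logarithm `0` by convention, against the strict entropy bound.
    rw [h0', Nat.cast_zero, Real.log_zero] at h3'
    have : (0 : ℝ) ≤ 2 * (k + 1) * (30 * 2 ^ (k + 2)) ^ d * ((box d n).card : ℝ) := by positivity
    linarith

lemma GoodScale.eventually_goodPair (hd : 0 < d) {ε δ : ℕ → ℝ} (h : IsScalePair ε δ)
    {C : ℕ → Finset X} {k n : ℕ} (hn : GoodScale d δ C k n) :
    ∀ᶠ m in atTop, GoodPair d ε δ C k n m := by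
  filter_upwards [eventually_muchLess hd h hn.one_le, eventually_gap h (k + 1) (coreRadius k n + n),
    eventually_hasCode hd h hn.one_le hn.nonempty hn.log_card] with m h1 h2 h3
  refine ⟨h1, ?_, h3⟩
  have h4 : (0 : ℝ) ≤ (1 / 2 : ℝ) ^ (k + 1 + 1) * m / 2 := by positivity
  have h5 : ((coreRadius (k + 1) m + coreRadius k n + n : ℕ) : ℝ) ≤ innerRadius δ m := by
    push_cast
    linarith
  exact_mod_cast h5

lemma exists_seq_of_step {α : Type*} {P : ℕ → α → Prop} {Q : ℕ → α → α → Prop}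
    (h0 : ∃ a, P 0 a) (hstep : ∀ k a, P k a → ∃ b, P (k + 1) b ∧ Q k a b) :
    ∃ f : ℕ → α, (∀ k, P k (f k)) ∧ ∀ k, Q k (f k) (f (k + 1)) := by
  obtain ⟨a, ha⟩ := h0
  choose! g hg using hstep
  let f : ℕ → α := fun k => Nat.rec a (fun k b => g k b) k
  have hf : ∀ k, P k (f k) := fun k => by
    induction k with
    | zero => exact ha
    | succ k ih => exact (hg k _ ih).1
  exact ⟨f, hf, fun k => (hg k _ (hf k)).2⟩

lemma exists_scales (hd : 0 < d) {ε δ : ℕ → ℝ} (h : IsScalePair ε δ) {C : ℕ → Finset X}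
    (hent : HasEntropy d C ⊤) :
    ∃ n : ℕ → ℕ, (∀ k, GoodScale d δ C k (n k)) ∧
      ∀ k, GoodPair d ε δ C k (n k) (n (k + 1)) :=
  exists_seq_of_step (eventually_goodScale h hent 0).exists fun k _ ha =>
    ((eventually_goodScale h hent (k + 1)).and (ha.eventually_goodPair hd h)).exists

end Scales

/-! ### Dynamical distances. -/

section Distances

variable {d : ℕ} {X : Type*} [MetricSpace X]

lemma pathDist_lt_iff {F : Finset (Zd d)} {w w' : Zd d → X} {r : ℝ} (hr : 0 < r) :
    pathDist F w w' < r ↔ ∀ i ∈ F, dist (w i) (w' i) < r := by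
  lift r to ℝ≥0 using hr.le
  rw [pathDist, NNReal.coe_lt_coe, Finset.sup_lt_iff (by simpa using hr)]
  simp only [← NNReal.coe_lt_coe, coe_nndist]

lemma pathDist_le_iff {F : Finset (Zd d)} {w w' : Zd d → X} {r : ℝ} (hr : 0 ≤ r) :
    pathDist F w w' ≤ r ↔ ∀ i ∈ F, dist (w i) (w' i) ≤ r := by
  lift r to ℝ≥0 using hr
  rw [pathDist, NNReal.coe_le_coe, Finset.sup_le_iff]
  simp only [← NNReal.coe_le_coe, coe_nndist]

variable [AddAction (Zd d) X]

lemma bowenDist_lt_iff {F : Finset (Zd d)} {x x' : X} {r : ℝ} (hr : 0 < r) :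
    bowenDist F x x' < r ↔ ∀ i ∈ F, dist (i +ᵥ x) (i +ᵥ x') < r :=
  pathDist_lt_iff hr

lemma IsSeparated.eq_of_dist_le {r : ℝ} (hr : 0 ≤ r) {F : Finset (Zd d)} {A : Set X}
    (hA : IsSeparated r F A) {x x' : X} (hx : x ∈ A) (hx' : x' ∈ A)
    (h : ∀ i ∈ F, dist (i +ᵥ x) (i +ᵥ x') ≤ r) : x = x' := by
  by_contra hne
  exact absurd (hA hx hx' hne) (not_lt.2 ((pathDist_le_iff hr).2 h))

end Distances

/-- A choice that depends only on discrete measurable data can be made measurably. -/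
lemma exists_measurable_selection {X Y D : Type*} [MeasurableSpace X] [MeasurableSpace Y]
    [MeasurableSpace D] [DiscreteMeasurableSpace D] {f : Y → D} (hf : Measurable f)
    {P : Y → X → Prop} (hP : ∀ y y' x, f y = f y' → P y x → P y' x) (hex : ∀ y, ∃ x, P y x) :
    ∃ c : Y → X, Measurable c ∧ ∀ y, P y (c y) := by
  choose g hg using hex
  rcases isEmpty_or_nonempty Y with hY | hY
  · exact ⟨g, measurable_of_empty g, hg⟩
  · refine ⟨fun y => g (Function.invFun f (f y)),
      (Measurable.of_discrete (f := fun δ => g (Function.invFun f δ))).comp hf, fun y => ?_⟩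
    exact hP _ _ _ (Function.invFun_eq ⟨y, rfl⟩) (hg _)

/-! ### Recursive choice of the words. -/

section Words

variable {d : ℕ} {X Y : Type*} [AddAction (Zd d) Y]

/-- The first `κ` bits of the names of the points `i +ᵥ y`, `i ∈ F_m`. -/
def message (φ : Y → ℕ → Bool) (m κ : ℕ) (y : Y) : box d m → Fin κ → Bool :=
  fun i l => φ ((i : Zd d) +ᵥ y) l

variable [MeasurableSpace Y] [MeasurableConstVAdd (Zd d) Y]

lemma measurable_message {φ : Y → ℕ → Bool} (hφ : Measurable φ) (m κ : ℕ) :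
    Measurable (message (d := d) φ m κ) :=
  measurable_pi_lambda _ fun i => measurable_pi_lambda _ fun l =>
    (measurable_pi_apply (l : ℕ)).comp (hφ.comp (measurable_const_vadd (i : Zd d)))

variable [MetricSpace X] [MeasurableSpace X] [BorelSpace X] [AddAction (Zd d) X]

/-- One application of flexibility to the old bases in the core together with the code positions.
The choice depends only on finitely many finite-valued data, so it can be made Borel. -/
lemma exists_next_words {ε δ : ℕ → ℝ} {C : ℕ → Finset X} (hflex : IsFlexible d ε δ C)
    {n m : ℕ} (hn : 1 ≤ n) (hm : 1 ≤ m) (hnm : MuchLess d ε δ n m) {R : ℕ}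
    (hR : R ≤ innerRadius δ m) {E : Finset (Zd d)} (hE : E ⊆ box d (innerRadius δ m))
    (hEE : ∀ e ∈ E, ∀ e' ∈ E, e ≠ e' → ∃ t, 2 * (outerRadius δ n : ℤ) < |e t - e' t|)
    (hER : ∀ e ∈ E, ∀ i ∈ box d R, ∃ t, 2 * (outerRadius δ n : ℤ) < |e t - i t|)
    {κ : ℕ} {enc : (box d m → Fin κ → Bool) → Zd d → X} (henc : ∀ w, ∀ e ∈ E, enc w e ∈ C n)
    {B : Set Y} (hBm : MeasurableSet B) (hB : IsPacked (d := d) (outerRadius δ n) B)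
    {φ : Y → ℕ → Bool} (hφ : Measurable φ) {c : Y → X} (hc : Measurable c)
    (hcC : ∀ y, c y ∈ C n) :
    ∃ c' : Y → X, Measurable c' ∧ ∀ y, c' y ∈ C m ∧
      (∀ i ∈ box d R, i +ᵥ y ∈ B →
        bowenDist (box d n) (i +ᵥ c' y) (c (i +ᵥ y)) < ε n / 4) ∧
      ∀ e ∈ E, bowenDist (box d n) (e +ᵥ c' y) (enc (message φ m κ y) e) < ε n / 4 := by
  classical
  let f : Y → (box d R → Prop × C n) × (box d m → Fin κ → Bool) := fun y =>
    (fun i => ((i : Zd d) +ᵥ y ∈ B, ⟨c ((i : Zd d) +ᵥ y), hcC _⟩), message φ m κ y)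
  have hf : Measurable f := by
    refine Measurable.prodMk (measurable_pi_lambda _ fun i => Measurable.prodMk ?_ ?_)
      (measurable_message hφ m κ)
    · exact hBm.mem.comp (measurable_const_vadd (i : Zd d))
    · exact (hc.comp (measurable_const_vadd (i : Zd d))).subtype_mk
  refine exists_measurable_selection hf (P := fun y x => x ∈ C m ∧
      (∀ i ∈ box d R, i +ᵥ y ∈ B → bowenDist (box d n) (i +ᵥ x) (c (i +ᵥ y)) < ε n / 4) ∧
      ∀ e ∈ E, bowenDist (box d n) (e +ᵥ x) (enc (message φ m κ y) e) < ε n / 4) ?_ ?_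
  · rintro y y' x hyy ⟨h1, h2, h3⟩
    have hmsg : message φ m κ y = message φ m κ y' := congrArg Prod.snd hyy
    refine ⟨h1, fun i hi hiB => ?_, hmsg ▸ h3⟩
    have h4 : ((i +ᵥ y ∈ B : Prop), (⟨c (i +ᵥ y), hcC _⟩ : C n)) =
        (i +ᵥ y' ∈ B, ⟨c (i +ᵥ y'), hcC _⟩) := congrFun (congrArg Prod.fst hyy) ⟨i, hi⟩
    have h5 : (i +ᵥ y ∈ B) = (i +ᵥ y' ∈ B) := congrArg Prod.fst h4
    have h6 : c (i +ᵥ y) = c (i +ᵥ y') := congrArg (fun p => (p.2 : X)) h4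
    rw [← h6]
    exact h2 i hi (h5 ▸ hiB)
  · intro y
    have hnotE : ∀ i ∈ box d R, i ∉ E := by
      intro i hi hiE
      obtain ⟨t, ht⟩ := hER i hiE i hi
      rw [sub_self, abs_zero] at ht
      omega
    set K : Finset (Zd d) := (box d R).filter (fun i => i +ᵥ y ∈ B) ∪ E with hK
    have hKsub : K ⊆ scaledBox d (1 - δ m) m := by
      refine Finset.union_subset ((Finset.filter_subset _ _).trans (box_mono hR)) hE
    have hKsp : IsSpaced (scaledBox d (1 + δ n) n) (K : Set (Zd d)) := by
      intro i hi j hj hij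
      change Disjoint ((fun k => i + k) '' (box d (outerRadius δ n) : Set (Zd d)))
        ((fun k => j + k) '' (box d (outerRadius δ n) : Set (Zd d)))
      rcases Finset.mem_union.1 (Finset.mem_coe.1 hi) with hi | hi <;>
        rcases Finset.mem_union.1 (Finset.mem_coe.1 hj) with hj | hj
      · rw [Set.disjoint_left]
        rintro _ ⟨u, hu, rfl⟩ ⟨v, hv, huv⟩
        beta_reduce at huv
        refine hij ?_
        have := hB _ (Finset.mem_filter.1 hi).2 _ (Finset.mem_filter.1 hj).2 u
          (Finset.mem_coe.1 hu) v (Finset.mem_coe.1 hv)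
          (by rw [vadd_vadd, vadd_vadd, add_comm u, add_comm v, huv])
        rw [this] at huv
        exact (add_right_cancel huv).symm
      · exact (disjoint_translates (hER j hj i (Finset.mem_filter.1 hi).1)).symm
      · exact disjoint_translates (hER i hi j (Finset.mem_filter.1 hj).1)
      · exact disjoint_translates (hEE i hi j hj hij)
    obtain ⟨x, hx, hsh⟩ := hflex.extend n m hn hm hnm K hKsub hKsp
      (fun i => if (i : Zd d) ∈ E then enc (message φ m κ y) i else c ((i : Zd d) +ᵥ y)) (by
        intro i
        split_ifs with h
        · exact henc _ _ h
        · exact hcC _)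
    refine ⟨x, hx, fun i hi hiB => ?_, fun e he => ?_⟩
    · have := hsh ⟨i, Finset.mem_union_left _ (Finset.mem_filter.2 ⟨hi, hiB⟩)⟩
      simpa only [if_neg (hnotE i hi)] using this
    · have := hsh ⟨e, Finset.mem_union_right _ he⟩
      simpa only [if_pos he] using this

/-- Words are chosen recursively so that those of step `k + 1` copy the words of step `k`
and determine the messages. -/
theorem exists_words {ε δ : ℕ → ℝ} {C : ℕ → Finset X} (hsc : IsScalePair ε δ)
    (hflex : IsFlexible d ε δ C) {n : ℕ → ℕ} (hgood : ∀ k, GoodScale d δ C k (n k))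
    (hpair : ∀ k, GoodPair d ε δ C k (n k) (n (k + 1))) {B : ℕ → Set Y}
    (hBm : ∀ k, MeasurableSet (B k))
    (hB : ∀ k, IsPacked (d := d) (outerRadius δ (n k)) (B k))
    {φ : Y → ℕ → Bool} (hφ : Measurable φ) :
    ∃ c : ℕ → Y → X, (∀ k, Measurable (c k) ∧ ∀ y, c k y ∈ C (n k)) ∧ ∀ k,
      (∀ y, ∀ i ∈ box d (coreRadius (k + 1) (n (k + 1)) + coreRadius k (n k)), i +ᵥ y ∈ B k →
        bowenDist (box d (n k)) (i +ᵥ c (k + 1) y) (c k (i +ᵥ y)) < ε (n k) / 4) ∧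
      (∀ y y', c (k + 1) y = c (k + 1) y' →
        message (d := d) φ (n (k + 1)) (k + 1) y = message φ (n (k + 1)) (k + 1) y') ∧
      ∀ y, ∀ x ∈ C (n k), ∃ e ∈ box d (n (k + 1)),
        bowenDist (box d (n k)) (e +ᵥ c (k + 1) y) x < ε (n k) / 4 := by
  refine (exists_seq_of_step
    (P := fun k (c : Y → X) => Measurable c ∧ ∀ y, c y ∈ C (n k))
    (Q := fun k c c' =>
      (∀ y, ∀ i ∈ box d (coreRadius (k + 1) (n (k + 1)) + coreRadius k (n k)), i +ᵥ y ∈ B k →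
        bowenDist (box d (n k)) (i +ᵥ c' y) (c (i +ᵥ y)) < ε (n k) / 4) ∧
      (∀ y y', c' y = c' y' →
        message (d := d) φ (n (k + 1)) (k + 1) y = message φ (n (k + 1)) (k + 1) y') ∧
      ∀ y, ∀ x ∈ C (n k), ∃ e ∈ box d (n (k + 1)),
        bowenDist (box d (n k)) (e +ᵥ c' y) x < ε (n k) / 4) ?_ ?_)
  · obtain ⟨x, hx⟩ := (hgood 0).nonempty
    exact ⟨fun _ => x, measurable_const, fun _ => hx⟩
  · rintro k c ⟨hcm, hcC⟩
    obtain ⟨E, enc, hE1, hE2, hE3, henc1, henc2, henc3⟩ := (hpair k).code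
    have hεk := (hsc.eps_mem _ (hgood k).one_le).1
    obtain ⟨c', hc'm, hc'⟩ := exists_next_words hflex (hgood k).one_le (hgood (k + 1)).one_le
      (hpair k).muchLess (by have := (hpair k).core_le; omega) hE1 hE2 hE3 henc1 (hBm k) (hB k)
      hφ hcm hcC
    refine ⟨c', ⟨hc'm, fun y => (hc' y).1⟩, fun y => (hc' y).2.1, fun y y' hyy => ?_,
      fun y x hx => ?_⟩
    -- Both code words at `e` are `ε / 4`-close to the same point, so separation identifies them.
    · refine henc2 _ _ fun e he => ?_
      refine (hflex.separated _ (hgood k).one_le).eq_of_dist_le hεk.le (henc1 _ e he)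
        (henc1 _ e he) fun i hi => ?_
      have h1 := (bowenDist_lt_iff (by positivity)).1 ((hc' y).2.2 e he) i hi
      have h2 := (bowenDist_lt_iff (by positivity)).1 ((hc' y').2.2 e he) i hi
      rw [hyy, dist_comm] at h1
      have h3 := dist_triangle (i +ᵥ enc (message φ (n (k + 1)) (k + 1) y) e) (i +ᵥ e +ᵥ c' y')
        (i +ᵥ enc (message φ (n (k + 1)) (k + 1) y') e)
      linarith
    · obtain ⟨e, he, hex⟩ := henc3 (message φ (n (k + 1)) (k + 1) y) x hx
      refine ⟨e, box_mono (innerRadius_le hsc (hgood (k + 1)).one_le) (hE1 he), ?_⟩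
      have := (hc' y).2.2 e he
      rwa [hex] at this

end Words

/-! ### Convergence along the towers. -/

section Limit

variable {d : ℕ} {X Y : Type*} [MetricSpace X] [AddAction (Zd d) X] [AddAction (Zd d) Y]

/-- A sequence of markers and words in which every step copies the core of the previous one. -/
structure IsTower (d : ℕ) {X Y : Type*} [MetricSpace X] [AddAction (Zd d) X]
    [AddAction (Zd d) Y] (n r : ℕ → ℕ) (e : ℕ → ℝ) (B : ℕ → Set Y) (c : ℕ → Y → X) : Prop where
  packed : ∀ k, IsPacked (d := d) (n k) (B k)
  core_le : ∀ k, r (k + 1) + r k + n k ≤ n (k + 1)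
  core_add : ∀ k, r k + k ≤ n k
  eps_pos : ∀ k, 0 < e k
  eps_succ : ∀ k, e (k + 1) ≤ e k / 4
  shadow : ∀ k y, ∀ i ∈ box d (r (k + 1) + r k), i +ᵥ y ∈ B k → ∀ l ∈ box d (n k),
    dist (l +ᵥ i +ᵥ c (k + 1) y) (l +ᵥ c k (i +ᵥ y)) < e k / 4

variable {n r : ℕ → ℕ} {e : ℕ → ℝ} {B : ℕ → Set Y} {c : ℕ → Y → X}

lemma IsTower.eps_add (h : IsTower d n r e B c) (k j : ℕ) : e (k + j) ≤ e k * (1 / 4) ^ j := by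
  induction j with
  | zero => simp
  | succ j ih =>
    have := h.eps_succ (k + j)
    rw [← add_assoc, pow_succ]
    linarith

/-- The point `y` lies in the core of the `k`-th marker box based at `-p k +ᵥ y`,
for all `k ≥ k₀`. -/
def IsAddress (r : ℕ → ℕ) (B : ℕ → Set Y) (k₀ : ℕ) (y : Y) (p : ℕ → Zd d) : Prop :=
  ∀ k, k₀ ≤ k → p k ∈ box d (r k) ∧ -p k +ᵥ y ∈ B k

/-- Consecutive addresses differ by at most `r (k + 1) + r k`, and `core_le` leaves room for the old
box. Hence the boxes around `y` are nested. -/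
lemma IsTower.mem_box (h : IsTower d n r e B c) {k₀ : ℕ} {y : Y} {p : ℕ → Zd d}
    (hp : IsAddress r B k₀ y p) {k : ℕ} (hk : k₀ ≤ k) {l : Zd d} (hl : l ∈ box d (n k)) (j : ℕ) :
    l - p k + p (k + j) ∈ box d (n (k + j)) := by
  induction j with
  | zero => simpa using hl
  | succ j ih =>
    have h1 := sub_mem_box (hp (k + j + 1) (by omega)).1 (hp (k + j) (by omega)).1
    have h2 := add_mem_box ih h1
    have h3 : l - p k + p (k + j) + (p (k + j + 1) - p (k + j)) = l - p k + p (k + (j + 1)) := by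
      rw [add_assoc, add_sub_cancel, add_assoc k j 1]
    rw [h3] at h2
    refine box_mono ?_ h2
    have := h.core_le (k + j)
    change _ ≤ n (k + j + 1)
    omega

lemma IsTower.dist_succ (h : IsTower d n r e B c) {k₀ : ℕ} {y : Y} {p : ℕ → Zd d}
    (hp : IsAddress r B k₀ y p) {k : ℕ} (hk : k₀ ≤ k) {l : Zd d} (hl : l ∈ box d (n k)) (j : ℕ) :
    dist ((l - p k) +ᵥ p (k + j) +ᵥ c (k + j) (-p (k + j) +ᵥ y))
      ((l - p k) +ᵥ p (k + (j + 1)) +ᵥ c (k + (j + 1)) (-p (k + (j + 1)) +ᵥ y)) ≤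
      e k / 4 * (1 / 4) ^ j := by
  have h1 := sub_mem_box (hp (k + j + 1) (by omega)).1 (hp (k + j) (by omega)).1
  have h2 : (p (k + j + 1) - p (k + j)) +ᵥ -p (k + j + 1) +ᵥ y = -p (k + j) +ᵥ y := by
    rw [vadd_vadd]
    congr 1
    abel
  have h3 := h.shadow (k + j) (-p (k + j + 1) +ᵥ y) _ h1
    (by rw [h2]; exact (hp (k + j) (by omega)).2) _ (h.mem_box hp hk hl j)
  rw [h2, dist_comm, vadd_vadd (l - p k + p (k + j)), add_assoc, add_sub_cancel, ← vadd_vadd,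
    ← vadd_vadd] at h3
  have h4 := h.eps_add k j
  rw [← add_assoc]
  linarith

lemma IsTower.exists_tendsto [CompleteSpace X] (h : IsTower d n r e B c) {k₀ : ℕ} {y : Y}
    {p : ℕ → Zd d} (hp : IsAddress r B k₀ y p) :
    ∃ x, Tendsto (fun k => p k +ᵥ c k (-p k +ᵥ y)) atTop (𝓝 x) := by
  have h1 := fun j => h.dist_succ hp le_rfl (l := p k₀)
    (box_mono (by have := h.core_add k₀; omega) (hp k₀ le_rfl).1) j
  simp only [sub_self, zero_vadd] at h1
  obtain ⟨x, hx⟩ := cauchySeq_tendsto_of_complete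
    (cauchySeq_of_le_geometric (1 / 4) _ (by norm_num) h1)
  refine ⟨x, (tendsto_add_atTop_iff_nat k₀).1 ?_⟩
  simpa only [add_comm k₀] using hx

/-- The errors `e k / 4 * (1 / 4) ^ j` sum to `e k / 3`. Two words with the same limit and address
are thus within `2 * e k / 3`, below the separation of the words. -/
lemma IsTower.dist_le [ContinuousConstVAdd (Zd d) X] (h : IsTower d n r e B c) {k₀ : ℕ} {y : Y}
    {p : ℕ → Zd d} (hp : IsAddress r B k₀ y p) {x : X}
    (hx : Tendsto (fun k => p k +ᵥ c k (-p k +ᵥ y)) atTop (𝓝 x)) {k : ℕ} (hk : k₀ ≤ k)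
    {l : Zd d} (hl : l ∈ box d (n k)) :
    dist (l +ᵥ c k (-p k +ᵥ y)) ((l - p k) +ᵥ x) ≤ e k / 3 := by
  have h1 : Tendsto (fun j => (l - p k) +ᵥ p (k + j) +ᵥ c (k + j) (-p (k + j) +ᵥ y)) atTop
      (𝓝 ((l - p k) +ᵥ x)) := by
    have := ((tendsto_add_atTop_iff_nat k).2 hx).const_vadd (l - p k)
    simpa only [add_comm k] using this
  have h2 := dist_le_of_le_geometric_of_tendsto (1 / 4) _ (by norm_num)
    (h.dist_succ hp hk hl) h1 0
  rw [add_zero, vadd_vadd, sub_add_cancel] at h2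
  refine h2.trans_eq ?_
  norm_num
  ring

end Limit

lemma MuchLess.eps_le {d : ℕ} (hd : 0 < d) {ε δ : ℕ → ℝ} (h : IsScalePair ε δ) {n m : ℕ} (hn : 1 ≤ n)
    (hnm : MuchLess d ε δ n m) : ε m ≤ ε n / 4 := by
  have he := h.eps_mem n hn
  have h1 : 1 / (10 ^ 6 * (d : ℝ)) ≤ 1 / 4 := by
    have : (1 : ℝ) ≤ d := by exact_mod_cast hd
    exact one_div_le_one_div_of_le (by norm_num) (by linarith)
  have h2 : (1 - ε n) / ((box d n).card : ℝ) ≤ 1 := by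
    have : (1 : ℝ) ≤ (box d n).card := by
      exact_mod_cast Finset.card_pos.2 ⟨0, zero_mem_box n⟩
    rw [div_le_one (by linarith)]
    linarith [he.1]
  have h3 : 1 / (10 ^ 6 * (d : ℝ)) * ε n ≤ 1 / 4 * ε n :=
    mul_le_mul_of_nonneg_right h1 he.1.le
  have h4 : 0 ≤ 1 / (10 ^ 6 * (d : ℝ)) * ε n := mul_nonneg (by positivity) he.1.le
  have h5 := mul_le_mul_of_nonneg_left h2 h4
  linarith [hnm.1]

/-! ### Addresses, Borel–Cantelli and measurable approximations. -/

section Towers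

variable {d : ℕ} {X Y : Type*} [MetricSpace X] [AddAction (Zd d) X] [AddAction (Zd d) Y]
  {n r : ℕ → ℕ} {e : ℕ → ℝ} {B : ℕ → Set Y} {c : ℕ → Y → X}

lemma IsPacked.mono {m n : ℕ} (h : m ≤ n) {B : Set Y} (hB : IsPacked (d := d) n B) :
    IsPacked (d := d) m B :=
  fun b hb b' hb' u hu v hv => hB b hb b' hb' u (box_mono h hu) v (box_mono h hv)

/-- Since `r k + k ≤ n k`, a fixed translate of a core point eventually stays in the same box, and
packing makes its address unique. Equivariance of the limit rests on this. -/
lemma IsTower.eventually_eq_add (h : IsTower d n r e B c) {k₀ k₁ : ℕ} {y : Y} {i : Zd d}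
    {p q : ℕ → Zd d} (hp : IsAddress r B k₀ y p) (hq : IsAddress r B k₁ (i +ᵥ y) q) :
    ∀ᶠ k in atTop, q k = i + p k := by
  obtain ⟨m, hm⟩ := exists_mem_box i
  filter_upwards [eventually_ge_atTop k₀, eventually_ge_atTop k₁, eventually_ge_atTop m]
    with k h0 h1 h2
  have h3 := h.core_add k
  refine (h.packed k _ (hp k h0).2 _ (hq k h1).2 _ ?_ _ ?_ ?_).symm
  · exact box_mono (by omega) (add_mem_box hm (hp k h0).1)
  · exact box_mono (by omega) (hq k h1).1
  · rw [vadd_vadd, vadd_vadd, add_neg_cancel, zero_vadd, add_neg_cancel_right]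

lemma exists_isAddress {y : Y} (h : ∀ᶠ k in atTop, y ∈ sweep d (r k) (B k)) :
    ∃ (k₀ : ℕ) (p : ℕ → Zd d), IsAddress r B k₀ y p := by
  obtain ⟨k₀, hk₀⟩ := eventually_atTop.1 h
  choose! p hp using hk₀
  exact ⟨k₀, p, hp⟩

/-- The points all of whose translates eventually lie in the given sets. -/
def tailSet (d : ℕ) {Y : Type*} [AddAction (Zd d) Y] (G : ℕ → Set Y) : Set Y :=
  {y | ∀ i : Zd d, ∀ᶠ k in atTop, i +ᵥ y ∈ G k}

lemma vadd_mem_tailSet {G : ℕ → Set Y} (i : Zd d) {y : Y} (hy : y ∈ tailSet d G) :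
    i +ᵥ y ∈ tailSet d G := fun j => by
  simpa only [vadd_vadd] using hy (j + i)

lemma tailSet_eventually {G : ℕ → Set Y} {y : Y} (hy : y ∈ tailSet d G) :
    ∀ᶠ k in atTop, y ∈ G k := by
  simpa only [zero_vadd] using hy 0

variable [MeasurableSpace Y]

lemma measure_compl_tailSet {G : ℕ → Set Y} (μ : Measure Y) [VAddInvariantMeasure (Zd d) Y μ]
    (hG : ∑' k, μ (G k)ᶜ ≠ ⊤) : μ (tailSet d G)ᶜ = 0 := by
  have hsub : (tailSet d G)ᶜ ⊆ ⋃ i : Zd d, {y | ∃ᶠ k in atTop, i +ᵥ y ∈ (G k)ᶜ} := by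
    intro y hy
    simp only [tailSet, Set.mem_compl_iff, Set.mem_ofPred_eq, not_forall] at hy
    obtain ⟨i, hi⟩ := hy
    exact Set.mem_iUnion.2 ⟨i, not_eventually.1 hi⟩
  refine measure_mono_null hsub (measure_iUnion_null fun i => ?_)
  refine measure_setOfPred_frequently_eq_zero ?_
  simpa only [measure_vadd_mem] using hG

variable [MeasurableConstVAdd (Zd d) Y]

/-- By invariance, restricting to a core loses the same proportion of the tower as of the box. -/
lemma IsPacked.measure_compl_sweep_le {a m : ℕ} (hma : m ≤ a) {B : Set Y}
    (hB : IsPacked (d := d) a B) (hBm : MeasurableSet B) {τ η : ℝ} (hτ : 0 ≤ τ)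
    (hshell : ((box d a).card : ℝ) - (box d m).card ≤ τ * (box d a).card)
    (μ : Measure Y) [IsProbabilityMeasure μ] [VAddInvariantMeasure (Zd d) Y μ]
    (hμ : μ (sweep d a B)ᶜ ≤ ENNReal.ofReal η) :
    μ (sweep d m B)ᶜ ≤ ENNReal.ofReal η + ENNReal.ofReal τ := by
  classical
  have hsub : (sweep d m B)ᶜ ⊆ (sweep d a B)ᶜ ∪
      ⋃ u ∈ box d a \ box d m, {y : Y | -u +ᵥ y ∈ B} := by
    intro y hy
    by_cases hya : y ∈ sweep d a B
    · obtain ⟨u, hu, huB⟩ := hya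
      refine Or.inr (Set.mem_iUnion₂.2 ⟨u, Finset.mem_sdiff.2 ⟨hu, fun hum => hy ?_⟩, huB⟩)
      exact ⟨u, hum, huB⟩
    · exact Or.inl hya
  refine (measure_mono hsub).trans ((measure_union_le _ _).trans (add_le_add hμ ?_))
  rw [hB.measure_biUnion hBm μ Finset.sdiff_subset]
  have h1 : ((box d a).card : ℝ) * μ.real B ≤ 1 := by
    have := ENNReal.toReal_mono ENNReal.one_ne_top (hB.card_mul_measure_le hBm μ)
    rwa [ENNReal.toReal_mul, ENNReal.toReal_natCast, ENNReal.toReal_one] at this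
  rw [ENNReal.le_ofReal_iff_toReal_le (by finiteness) hτ, ENNReal.toReal_mul,
    ENNReal.toReal_natCast, Finset.card_sdiff_of_subset (box_mono hma),
    Nat.cast_sub (Finset.card_le_card (box_mono hma))]
  calc (((box d a).card : ℝ) - (box d m).card) * μ.real B
      ≤ τ * (box d a).card * μ.real B := by gcongr
    _ = τ * ((box d a).card * μ.real B) := by ring
    _ ≤ τ := mul_le_of_le_one_right hτ h1

lemma measurableSet_tailSet {G : ℕ → Set Y} (hG : ∀ k, MeasurableSet (G k)) :
    MeasurableSet (tailSet d G) := by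
  have : tailSet d G = ⋂ i : Zd d, ⋃ K : ℕ, ⋂ k ≥ K, {y | i +ᵥ y ∈ G k} := by
    ext y
    simp [tailSet, eventually_atTop]
  rw [this]
  exact MeasurableSet.iInter fun i => MeasurableSet.iUnion fun K => MeasurableSet.iInter fun k =>
    MeasurableSet.iInter fun _ => measurableSet_vadd_mem (hG k) i

variable [MeasurableSpace X] [BorelSpace X]

/-- The finite-stage approximations of the embedding. -/
lemma exists_approx [Nonempty X] {C : Finset X} {r : ℕ} {B : Set Y} {c : Y → X}
    (hB : IsPacked (d := d) r B) (hBm : MeasurableSet B) (hc : Measurable c)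
    (hcC : ∀ y, c y ∈ C) :
    ∃ g : Y → X, Measurable g ∧
      ∀ y, ∀ j ∈ box d r, -j +ᵥ y ∈ B → g y = j +ᵥ c (-j +ᵥ y) := by
  let f : Y → (box d r → Prop × C) := fun y j =>
    (-(j : Zd d) +ᵥ y ∈ B, ⟨c (-(j : Zd d) +ᵥ y), hcC _⟩)
  have hf : Measurable f := by
    refine measurable_pi_lambda _ fun j => Measurable.prodMk ?_ ?_
    · exact hBm.mem.comp (measurable_const_vadd (-(j : Zd d)))
    · exact (hc.comp (measurable_const_vadd (-(j : Zd d)))).subtype_mk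
  refine exists_measurable_selection hf (P := fun y x => ∀ j ∈ box d r, -j +ᵥ y ∈ B →
    x = j +ᵥ c (-j +ᵥ y)) ?_ ?_
  · intro y y' x hyy h j hj hjB
    have h4 : ((-j +ᵥ y ∈ B : Prop), (⟨c (-j +ᵥ y), hcC _⟩ : C)) =
        (-j +ᵥ y' ∈ B, ⟨c (-j +ᵥ y'), hcC _⟩) := congrFun hyy ⟨j, hj⟩
    have h5 : (-j +ᵥ y ∈ B) = (-j +ᵥ y' ∈ B) := congrArg Prod.fst h4
    have h6 : c (-j +ᵥ y) = c (-j +ᵥ y') := congrArg (fun p => (p.2 : X)) h4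
    rw [← h6]
    exact h j hj (h5 ▸ hjB)
  · intro y
    by_cases h : ∃ j ∈ box d r, -j +ᵥ y ∈ B
    · obtain ⟨j, hj, hjB⟩ := h
      refine ⟨j +ᵥ c (-j +ᵥ y), fun j' hj' hjB' => ?_⟩
      rw [hB _ hjB _ hjB' j hj j' hj' (by simp)]
    · exact ⟨Classical.arbitrary X, fun j hj hjB => absurd ⟨j, hj, hjB⟩ h⟩

end Towers

/-! ### Density of the late words. -/

section Density

variable {d : ℕ} {X : Type*} [MetricSpace X] [AddAction (Zd d) X]

/-- If `X` is perfect and the union of a flexible sequence is dense, then every nonempty open set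
meets all its late members. -/
lemma IsFlexible.eventually_exists_dist_lt [PerfectSpace X] (hd : 0 < d) {C : ℕ → Finset X}
    {ε δ : ℕ → ℝ} (hsc : IsScalePair ε δ) (hflex : IsFlexible d ε δ C)
    (hdense : Dense (⋃ k ≥ 1, (C k : Set X))) (u : X) {s : ℝ} (hs : 0 < s) :
    ∀ᶠ m in atTop, ∃ x ∈ C m, dist x u < s := by
  obtain ⟨K, hK⟩ := eventually_atTop.1 (hsc.eps_lim.eventually_lt_const hs)
  -- Perfectness allows removing the finitely many early words, so that the word found has `ε k <
  -- s`. Flexibility with the single position `0` then carries it to all large scales.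
  set A : Set X := ⋃ k ∈ Finset.range K, (C k : Set X) with hA
  have hAfin : A.Finite := (Finset.range K).finite_toSet.biUnion fun k _ => (C k).finite_toSet
  have hopen : IsOpen (Metric.ball u (s / 2) \ A) := Metric.isOpen_ball.sdiff hAfin.isClosed
  have hne : (Metric.ball u (s / 2) \ A).Nonempty := by
    have hinf : (Metric.ball u (s / 2)).Infinite :=
      infinite_of_mem_nhds u (Metric.ball_mem_nhds u (by positivity))
    exact (hinf.sdiff hAfin).nonempty
  obtain ⟨x, ⟨hxu, hxA⟩, hxC⟩ := hdense.inter_open_nonempty _ hopen hne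
  obtain ⟨k, hk1, hxk⟩ := Set.mem_iUnion₂.1 hxC
  have hkK : K ≤ k := by
    by_contra hlt
    exact hxA (Set.mem_iUnion₂.2 ⟨k, Finset.mem_range.2 (by omega), hxk⟩)
  have hεk := (hsc.eps_mem k hk1).1
  filter_upwards [eventually_muchLess hd hsc hk1, eventually_ge_atTop 1] with m hm hm1
  obtain ⟨x', hx', hsh⟩ := hflex.extend k m hk1 hm1 hm {0}
    (Finset.singleton_subset_iff.2 (zero_mem_box _)) (by simp [IsSpaced]) (fun _ => x) (fun _ => hxk)
  refine ⟨x', hx', ?_⟩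
  have h1 := (bowenDist_lt_iff (by positivity)).1 (hsh ⟨0, by simp⟩) 0 (zero_mem_box _)
  simp only [zero_vadd] at h1
  have h2 := hK k hkK
  have h3 := dist_triangle x' x u
  rw [Metric.mem_ball] at hxu
  linarith

end Density

/-! ### The embedding. -/

section Main

variable {d : ℕ} {X Y : Type*} [MetricSpace X] [CompactSpace X] [MeasurableSpace X] [BorelSpace X]
  [AddAction (Zd d) X] [ContinuousConstVAdd (Zd d) X] [MeasurableSpace Y] [StandardBorelSpace Y]
  [AddAction (Zd d) Y] [MeasurableConstVAdd (Zd d) Y]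

/-- An almost Borel embedding whose image comes close to every word of the flexible sequence,
along a subsequence of scales, with positive probability. -/
theorem exists_embedding (hd : 0 < d) {C : ℕ → Finset X} {ε δ : ℕ → ℝ} (hsc : IsScalePair ε δ)
    (hflex : IsFlexible d ε δ C) (hmark : HasMarkerProperty d δ C) (hent : HasEntropy d C ⊤)
    (hfree : ∀ (i : Zd d) (y : Y), i ≠ 0 → i +ᵥ y ≠ y) :
    ∃ (n : ℕ → ℕ) (Y₀ : Set Y) (ρ : Y₀ → X), Tendsto n atTop atTop ∧
      IsAlmostBorelEmbedding d Y₀ ρ ∧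
      ∀ μ : Measure Y, IsProbabilityMeasure μ → VAddInvariantMeasure (Zd d) Y μ →
        ∀ᶠ k in atTop, ∀ x ∈ C (n k),
          μ {y | ∃ h : y ∈ Y₀, dist (ρ ⟨y, h⟩) x < ε (n k)} ≠ 0 := by
  obtain ⟨n, hgood, hpair⟩ := exists_scales hd hsc hent
  obtain ⟨φ, hφm, hφi⟩ := MeasurableSpace.measurable_injection_nat_bool_of_countablySeparated Y
  choose B hBm hBp hBμ using fun k : ℕ =>
    exists_rokhlin (Y := Y) hfree (outerRadius δ (n k)) (η := (1 / 2 : ℝ) ^ k) (by positivity)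
  obtain ⟨c, hcC, hc⟩ := exists_words hsc hflex hgood hpair hBm hBp hφm
  set r : ℕ → ℕ := fun k => coreRadius k (n k) with hr
  set e : ℕ → ℝ := fun k => ε (n k) with he
  have he0 : ∀ k, 0 < e k := fun k => (hsc.eps_mem _ (hgood k).one_le).1
  have htow : IsTower d n r e B c := by
    refine ⟨fun k => (hBp k).mono (le_outerRadius hsc (hgood k).one_le),
      fun k => (hpair k).core_le.trans (innerRadius_le hsc (hgood (k + 1)).one_le),
      fun k => (hgood k).core_add, he0,
      fun k => (hpair k).muchLess.eps_le hd hsc (hgood k).one_le, fun k y i hi hiB l hl => ?_⟩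
    have := he0 k
    exact (bowenDist_lt_iff (by positivity)).1 ((hc k).1 y i hi hiB) l hl
  have hrn : ∀ k, r k ≤ n k := fun k => (Nat.le_add_right _ _).trans (hgood k).core_add
  have hntop : Tendsto n atTop atTop :=
    tendsto_atTop_mono (fun k => (Nat.le_add_left k _).trans (hgood k).core_add) tendsto_id
  have hetop : Tendsto e atTop (𝓝 0) := hsc.eps_lim.comp hntop
  have : Nonempty X := ⟨(hgood 0).nonempty.choose⟩
  choose g hgm hg using fun k => exists_approx (C := C (n k))
    ((htow.packed k).mono (hrn k)) (hBm k) (hcC k).1 (hcC k).2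
  set Y₀ : Set Y := tailSet d fun k => sweep d (r k) (B k) with hY₀
  have hlim : ∀ y : Y₀, ∃ x, Tendsto (fun k => g k y) atTop (𝓝 x) := by
    rintro ⟨y, hy⟩
    obtain ⟨k₀, p, hp⟩ := exists_isAddress (tailSet_eventually hy)
    obtain ⟨x, hx⟩ := htow.exists_tendsto hp
    refine ⟨x, hx.congr' ?_⟩
    filter_upwards [eventually_ge_atTop k₀] with k hk
    exact (hg k y _ (hp k hk).1 (hp k hk).2).symm
  choose ρ hρ using hlim
  have hρp : ∀ (y : Y₀) {k₀ : ℕ} {p : ℕ → Zd d}, IsAddress r B k₀ (y : Y) p →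
      Tendsto (fun k => p k +ᵥ c k (-p k +ᵥ (y : Y))) atTop (𝓝 (ρ y)) := by
    intro y k₀ p hp
    refine (hρ y).congr' ?_
    filter_upwards [eventually_ge_atTop k₀] with k hk
    exact hg k y _ (hp k hk).1 (hp k hk).2
  have hfull : ∀ μ : Measure Y, IsProbabilityMeasure μ → VAddInvariantMeasure (Zd d) Y μ →
      μ Y₀ᶜ = 0 := by
    intro μ hμ hμi
    refine measure_compl_tailSet μ (ne_top_of_le_ne_top ?_ (ENNReal.tsum_le_tsum fun k =>
      (hBp k).measure_compl_sweep_le ((hrn k).trans (le_outerRadius hsc (hgood k).one_le))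
        (hBm k) (by positivity) (hgood k).shell μ (hBμ k μ hμ hμi)))
    rw [ENNReal.tsum_add]
    refine ENNReal.add_ne_top.2 ⟨?_, ?_⟩
    · exact (summable_geometric_of_lt_one (by norm_num) (by norm_num)).tsum_ofReal_ne_top
    · refine Summable.tsum_ofReal_ne_top (Summable.mul_left _ ?_)
      exact (summable_nat_add_iff 1).2
        (summable_geometric_of_lt_one (by norm_num : (0 : ℝ) ≤ 1 / 2) (by norm_num))
  have hinv : ∀ (i : Zd d) (y : Y), y ∈ Y₀ → i +ᵥ y ∈ Y₀ := fun i y hy => vadd_mem_tailSet i hy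
  have hequi : ∀ (i : Zd d) (y : Y) (hy : y ∈ Y₀), ρ ⟨i +ᵥ y, hinv i y hy⟩ = i +ᵥ ρ ⟨y, hy⟩ := by
    intro i y hy
    obtain ⟨k₀, p, hp⟩ := exists_isAddress (tailSet_eventually hy)
    obtain ⟨k₁, q, hq⟩ := exists_isAddress (tailSet_eventually (hinv i y hy))
    refine tendsto_nhds_unique (hρp ⟨_, hinv i y hy⟩ hq)
      (((hρp ⟨y, hy⟩ hp).const_vadd i).congr' ?_)
    filter_upwards [htow.eventually_eq_add hp hq] with k hk
    rw [hk, vadd_vadd i (p k), vadd_vadd (-(i + p k)) i y]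
    congr 3
    abel
  have hmeas : Measurable ρ :=
    measurable_of_tendsto_metrizable (fun k => (hgm k).comp measurable_subtype_coe)
      (tendsto_pi_nhds.2 hρ)
  have hinj : Function.Injective ρ := by
    rintro ⟨y, hy⟩ ⟨y', hy'⟩ hyy
    obtain ⟨k₀, p, hp⟩ := exists_isAddress (tailSet_eventually hy)
    obtain ⟨k₁, q, hq⟩ := exists_isAddress (tailSet_eventually hy')
    have hpx := hρp ⟨y, hy⟩ hp
    have hqx := hρp ⟨y', hy'⟩ hq
    rw [← hyy] at hqx
    set x := ρ ⟨y, hy⟩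
    obtain ⟨s, hs, hsp⟩ := hmark
    rw [Subtype.mk.injEq]
    refine hφi (funext fun b => ?_)
    obtain ⟨k, hk0, hk1, hkb, hks⟩ := ((eventually_ge_atTop k₀).and ((eventually_ge_atTop k₁).and
      ((eventually_gt_atTop b).and (hetop.eventually_lt_const hs)))).exists
    -- Messages are written only from step `1` on. The word of step `k + 1` records `k + 1` bits,
    -- enough to include bit `b`.
    obtain ⟨k, rfl⟩ : ∃ j, k = j + 1 := ⟨k - 1, by omega⟩
    have hin : ∀ z ∈ box d (r (k + 1)), z ∈ box d (innerRadius δ (n (k + 1))) := fun z hz =>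
      box_mono (by have := (hpair k).core_le; simp only [hr]; omega) hz
    have hclose : ∀ (z : Zd d) (v : X), (∀ l ∈ box d (n (k + 1)),
        dist (l +ᵥ v) ((l - z) +ᵥ x) ≤ e (k + 1) / 3) → v ∈ C (n (k + 1)) →
        -z ∈ {i : Zd d | ∃ c ∈ C (n (k + 1)), pathDist (box d (n (k + 1)))
          (fun j => orbitPath d x (i + j)) (orbitPath d c) < s} := by
      intro z v h hv
      refine ⟨v, hv, (pathDist_lt_iff hs).2 fun l hl => ?_⟩
      have h1 := h l hl
      rw [dist_comm, sub_eq_neg_add] at h1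
      have := he0 (k + 1)
      exact h1.trans_lt (by linarith)
    have hdp := fun l hl => htow.dist_le hp hpx hk0 (l := l) hl
    have hdq := fun l hl => htow.dist_le hq hqx hk1 (l := l) hl
    -- Both `-p` and `-q` are markers in the orbit of `x`. Their inner boxes contain `0`, so spacing
    -- forces them to coincide.
    have hpq : p (k + 1) = q (k + 1) := by
      by_contra hne
      have h1 := hsp (orbitPath d x) (n (k + 1)) (hgood _).one_le
        (hclose _ _ hdp ((hcC _).2 _)) (hclose _ _ hdq ((hcC _).2 _)) (neg_injective.ne hne)
      have h2 := Set.disjoint_left.1 h1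
      exact @h2 0 ⟨p (k + 1), Finset.mem_coe.2 (hin _ (hp _ hk0).1), neg_add_cancel _⟩
        ⟨q (k + 1), Finset.mem_coe.2 (hin _ (hq _ hk1).1), neg_add_cancel _⟩
    rw [← hpq] at hdq
    have hword : c (k + 1) (-p (k + 1) +ᵥ y) = c (k + 1) (-p (k + 1) +ᵥ y') := by
      refine (hflex.separated _ (hgood (k + 1)).one_le).eq_of_dist_le (he0 (k + 1)).le
        ((hcC _).2 _) ((hcC _).2 _) fun l hl => ?_
      have h1 := hdp l hl
      have h2 := hdq l hl
      rw [dist_comm] at h2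
      have h3 := dist_triangle (l +ᵥ c (k + 1) (-p (k + 1) +ᵥ y)) ((l - p (k + 1)) +ᵥ x)
        (l +ᵥ c (k + 1) (-p (k + 1) +ᵥ y'))
      have := he0 (k + 1)
      change _ ≤ e (k + 1)
      linarith
    -- Site `p (k + 1)` of the box is the point `y` itself, respectively `y'`.
    have hmsg := congrFun (congrFun ((hc k).2.1 _ _ hword)
      ⟨p (k + 1), box_mono (hrn _) (hp _ hk0).1⟩) ⟨b, hkb⟩
    simpa only [message, vadd_vadd, add_neg_cancel, zero_vadd] using hmsg
  refine ⟨n, Y₀, ρ, hntop, ⟨measurableSet_tailSet fun k => measurableSet_sweep _ (hBm k), hinv,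
    hfull, hmeas, hinj, hequi⟩, fun μ hμ hμi => ?_⟩
  set Z : ℕ → Set Y := fun K => Y₀ ∩ {y | ∀ k ≥ K, y ∈ sweep d (r k) (B k)} with hZ
  have hZU : Y₀ = ⋃ K, Z K := by
    refine Set.Subset.antisymm (fun y hy => ?_) (Set.iUnion_subset fun K => Set.inter_subset_left)
    obtain ⟨K, hK⟩ := eventually_atTop.1 (tailSet_eventually hy)
    exact Set.mem_iUnion.2 ⟨K, hy, hK⟩
  obtain ⟨K, hK⟩ : ∃ K, μ (Z K) ≠ 0 := by
    by_contra! hcon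
    have h1 : μ Y₀ = 0 := by rw [hZU]; exact measure_iUnion_null hcon
    have h2 : μ Set.univ = 0 := by
      rw [← Set.union_compl_self Y₀]
      exact measure_union_null h1 (hfull μ hμ hμi)
    simp at h2
  filter_upwards [eventually_ge_atTop K] with k hk x hx h0
  -- Every point of `Z K` has a translate whose image is close to `x`. If the set of such points
  -- were null, invariance would make `Z K` null.
  refine hK (measure_mono_null (?_ : Z K ⊆ ⋃ t : Zd d,
    {y | t +ᵥ y ∈ {y | ∃ h : y ∈ Y₀, dist (ρ ⟨y, h⟩) x < ε (n k)}})
    (measure_iUnion_null fun t => by rw [measure_vadd_mem, h0]))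
  intro y hy
  obtain ⟨hy0, hyK⟩ := hy
  choose! p hp using hyK
  obtain ⟨z, hz, hzx⟩ := (hc k).2.2 (-p (k + 1) +ᵥ y) x hx
  have hek := he0 k
  have h1 := (bowenDist_lt_iff (show 0 < e k / 4 by positivity)).1 hzx 0 (zero_mem_box _)
  rw [zero_vadd, zero_vadd] at h1
  have h2 := htow.dist_le hp (hρp ⟨y, hy0⟩ hp) (k := k + 1) (by omega) hz
  rw [dist_comm] at h2
  have h3 := htow.eps_succ k
  have h4 := dist_triangle ((z - p (k + 1)) +ᵥ ρ ⟨y, hy0⟩)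
    (z +ᵥ c (k + 1) (-p (k + 1) +ᵥ y)) x
  have h5 : dist ((z - p (k + 1)) +ᵥ ρ ⟨y, hy0⟩) x < e k := by
    change _ < e k / 4 at h1
    linarith
  exact Set.mem_iUnion.2 ⟨z - p (k + 1), hinv _ y hy0, (hequi _ y hy0).symm ▸ h5⟩

end Main

end FlexEmb

theorem theorem1p2 {d : ℕ} (hd : 0 < d)
    {X : Type*} [MetricSpace X] [CompactSpace X] [MeasurableSpace X] [BorelSpace X]
    [AddAction (FlexEmb.Zd d) X] [ContinuousConstVAdd (FlexEmb.Zd d) X]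
    (C : ℕ → Finset X) (hC : FlexEmb.IsFlexibleMarkerSequence d C)
    (hent : FlexEmb.HasEntropy d C ⊤)
    {Y : Type*} [MeasurableSpace Y] [StandardBorelSpace Y]
    [AddAction (FlexEmb.Zd d) Y] [MeasurableConstVAdd (FlexEmb.Zd d) Y]
    (hfree : ∀ (i : FlexEmb.Zd d) (y : Y), i ≠ 0 → i +ᵥ y ≠ y) :
    (∃ (Y₀ : Set Y) (ρ : Y₀ → X), FlexEmb.IsAlmostBorelEmbedding d Y₀ ρ) ∧
    (PerfectSpace X → Dense (⋃ k ≥ 1, (C k : Set X)) →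
      ∃ (Y₀ : Set Y) (ρ : Y₀ → X), FlexEmb.IsAlmostBorelEmbedding d Y₀ ρ ∧
        ∀ μ : Measure Y, IsProbabilityMeasure μ → VAddInvariantMeasure (FlexEmb.Zd d) Y μ →
          (Measure.map ρ (Measure.comap (Subtype.val : Y₀ → Y) μ)).support = Set.univ) := by
  obtain ⟨ε, δ, hsc, hflex, hmark⟩ := hC
  obtain ⟨n, Y₀, ρ, hn, hρ, hpos⟩ := FlexEmb.exists_embedding hd hsc hflex hmark hent hfree
  refine ⟨⟨Y₀, ρ, hρ⟩, fun hperf hdense => ⟨Y₀, ρ, hρ, fun μ hμ hμi => ?_⟩⟩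
  refine Set.eq_univ_of_forall fun u => ?_
  rw [Metric.nhds_basis_ball.mem_measureSupport]
  intro s hs
  obtain ⟨k, hk1, hk2, hk3⟩ := ((hpos μ hμ hμi).and ((hn.eventually
    (hflex.eventually_exists_dist_lt hd hsc hdense u (half_pos hs))).and
    ((hsc.eps_lim.comp hn).eventually_lt_const (half_pos hs)))).exists
  obtain ⟨x, hx, hxu⟩ := hk2
  refine pos_iff_ne_zero.2 fun h0 => hk1 x hx ?_
  rw [Measure.map_apply hρ.measurable Metric.isOpen_ball.measurableSet,
    (MeasurableEmbedding.subtype_coe hρ.measurableSet).comap_apply] at h0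
  refine measure_mono_null ?_ h0
  rintro y ⟨hy, hyx⟩
  refine ⟨⟨y, hy⟩, ?_, rfl⟩
  rw [Set.mem_preimage, Metric.mem_ball]
  have h1 := dist_triangle (ρ ⟨y, hy⟩) x u
  change ε (n k) < s / 2 at hk3
  linarith
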